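/- **Conventions.** Tensor products of Hilbert spaces are completed, tensor products of $C^*$-algebras are minimal, and $\bigoplus_a A_a=\{(x_a): x_a\in A_a,\ \|x_a\|\to 0\}$ for a family of $C^*$-algebras. Let $\mathsf M$ be a monoid with unit $e$ such that $\mathcal N_a=\{(b,c)\in\mathsf M\times\mathsf M: bc=a\}$ is finite for every $a\in\mathsf M$. A *$C^*$-weakly coassociative system* ($C^*$-WCS) over $\mathsf M$ consists of unital $C^*$-algebras $A_a$ and unital $*$-homomorphisms $\varphi_{a,b}:A_{ab}\to A_a\otimes A_b$ ($a,b\in\mathsf M$) such that (1) $(\mathrm{id}_a\otimes\varphi_{b,c})\circ\varphi_{a,bc}=(\varphi_{a,b}\otimes \mathrm{id}_c)\circ\varphi_{ab,c}$ for all $a,b,c$; (2) $(A_e,\varphi_{e,e})$ is a strictly proper $C^*$-bialgebra (defined below) with a counit, i.e. a $*$-homomorphism $\varepsilon:A_e\to\mathbb C$ with $(\varepsilon\otimes\mathrm{id})\varphi_{e,e}=\mathrm{id}=(\mathrm{id}\otimes\varepsilon)\varphi_{e,e}$; (3) $\varphi_{e,a}(x)=I_e\otimes x$ and $\varphi_{a,e}(x)=x\otimes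 I_e$ for $x\in A_a$, $a\in\mathsf M$. The associated strictly proper $C^*$-bialgebra is $(A_*,\Delta_\varphi)$, where $A_*=\bigoplus_{a}A_a$ and $\Delta_\varphi:A_*\to A_*\otimes A_*$ is the $*$-homomorphism with $\Delta_\varphi(x)=\sum_{(b,c)\in\mathcal N_a}\varphi_{b,c}(x)$ for $x\in A_a$. (Here a strictly proper $C^*$-bialgebra is a $C^*$-algebra $A$ with a $*$-homomorphism $\Delta:A\to A\otimes A$ such that $(\Delta\otimes\mathrm{id})\Delta=(\mathrm{id}\otimes\Delta)\Delta$ and the span of $\{\Delta(a)(b\otimes c)\}$ is dense in $A\otimes A$.) A *quasi-covariant representation* of a strictly proper $C^*$-bialgebra $(A,\Delta)$ is a triple $(\mathcal H,\pi,W)$ of a Hilbert space $\mathcal H$, a $*$-representation $\pi$ of $A$ on $\mathcal H$ and a nonzero partial isometry $W$ on $\mathcal H\otimes\mathcal H$ with $W(\pi(a)\otimes I)=(\pi\otimes\pi)(\Delta(a))W$ for all $a\in A$. It is *covariant* if $W^*$ is an isometry, and *pentagonal* if $W_{12}W_{13}W_{23}=W_{23}W_{12}$ on $\mathcal H\otimes\mathcal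 H\otimes\mathcal H$. A *quasi-covariant representation* of a $C^*$-WCS consists of unital $*$-representations $(\mathcal H_a,\pi_a)$ of $A_a$ ($a\in\mathsf M$) and nonzero partial isometries $W^{(a,b)}:\mathcal H_{ab}\otimes\mathcal H_b\to\mathcal H_a\otimes\mathcal H_b$ with $W^{(a,b)}(\pi_{ab}(x)\otimes I_b)=(\pi_a\otimes\pi_b)(\varphi_{a,b}(x))W^{(a,b)}$ for all $a,b\in\mathsf M$, $x\in A_{ab}$. It is *covariant* if every $(W^{(a,b)})^*$ is an isometry, and *pentagonal* if $W^{(a,b)}_{12}W^{(ab,c)}_{13}W^{(b,c)}_{23}=W^{(b,c)}_{23}W^{(a,bc)}_{12}$ on $\mathcal H_{abc}\otimes\mathcal H_{bc}\otimes\mathcal H_c$ for all $a,b,c\in\mathsf M$. **Proposition.** Assume in addition that $\mathsf M$ is cancellative ($bc=b'c$ implies $b=b'$, and $cb=cb'$ implies $b=b'$). Let $(\{(\mathcal H_a,\pi_a)\},\{W^{(a,b)}\})$ be a quasi-covariant representation of a $C^*$-WCS $(\{A_a\},\{\varphi_{a,b}\})$ over $\mathsf M$. Put $\mathcal H=\bigoplus_a\mathcal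 H_a$, $\pi=\bigoplus_a\pi_a$ and $W=\bigoplus_{a,b}W^{(a,b)}$, i.e. $W$ is the operator on $\mathcal H\otimes\mathcal H=\bigoplus_{a,b}\mathcal H_a\otimes\mathcal H_b$ that restricts to $W^{(a,b)}:\mathcal H_{ab}\otimes\mathcal H_b\to\mathcal H_a\otimes\mathcal H_b$ for all $a,b$ and vanishes on $\mathcal H_c\otimes\mathcal H_b$ if $c\notin\mathsf Mb$. Then: (i) $(\mathcal H,\pi,W)$ is a quasi-covariant representation of $(A_*,\Delta_\varphi)$; (ii) if the given representation of the $C^*$-WCS is covariant, then $(\mathcal H,\pi,W)$ is a covariant representation of $(A_*,\Delta_\varphi)$; (iii) if the given representation of the $C^*$-WCS is pentagonal, then $(\mathcal H,\pi,W)$ is pentagonal. -/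

import Mathlib

universe u

open scoped TensorProduct ENNReal Topology

noncomputable section

namespace CWCS

/-! ### Hilbert space tensor products -/

section HilbertTensor

/-- The Hilbert space tensor product: the completion of the algebraic tensor product with the inner
product `⟪x ⊗ y, x' ⊗ y'⟫ = ⟪x, x'⟫ ⟪y, y'⟫`. -/
def HTensor (H K : Type*) [NormedAddCommGroup H] [InnerProductSpace ℂ H]
    [NormedAddCommGroup K] [InnerProductSpace ℂ K] : Type _ :=
  UniformSpace.Completion (H ⊗[ℂ] K)

variable {H K L H' K' H'' K'' : Type*}
  [NormedAddCommGroup H] [InnerProductSpace ℂ H] [NormedAddCommGroup K] [InnerProductSpace ℂ K]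
  [NormedAddCommGroup L] [InnerProductSpace ℂ L]
  [NormedAddCommGroup H'] [InnerProductSpace ℂ H'] [NormedAddCommGroup K'] [InnerProductSpace ℂ K']
  [NormedAddCommGroup H''] [InnerProductSpace ℂ H'']
  [NormedAddCommGroup K''] [InnerProductSpace ℂ K'']

instance : NormedAddCommGroup (HTensor H K) :=
  inferInstanceAs (NormedAddCommGroup (UniformSpace.Completion (H ⊗[ℂ] K)))

instance : InnerProductSpace ℂ (HTensor H K) :=
  inferInstanceAs (InnerProductSpace ℂ (UniformSpace.Completion (H ⊗[ℂ] K)))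

instance : CompleteSpace (HTensor H K) :=
  inferInstanceAs (CompleteSpace (UniformSpace.Completion (H ⊗[ℂ] K)))

namespace HTensor

variable (H K) in
/-- The inclusion of the algebraic tensor product. -/
def incl : H ⊗[ℂ] K →ₗᵢ[ℂ] HTensor H K :=
  (UniformSpace.Completion.toComplₗᵢ : H ⊗[ℂ] K →ₗᵢ[ℂ] UniformSpace.Completion (H ⊗[ℂ] K))

lemma denseRange_incl : DenseRange (incl H K) :=
  UniformSpace.Completion.denseRange_coe (α := H ⊗[ℂ] K)

/-- The elementary tensor `x ⊗ y`. -/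
def tmul (x : H) (y : K) : HTensor H K := incl H K (x ⊗ₜ[ℂ] y)

lemma norm_tmul (x : H) (y : K) : ‖tmul x y‖ = ‖x‖ * ‖y‖ := by
  simp [tmul]

lemma inner_tmul (x x' : H) (y y' : K) :
    inner ℂ (tmul x y) (tmul x' y') = inner ℂ x x' * inner ℂ y y' := by
  simp [tmul, LinearIsometry.inner_map_map]

variable (H K) in
/-- `tmul` as a continuous bilinear map. -/
def mkL : H →L[ℂ] K →L[ℂ] HTensor H K :=
  (ContinuousLinearMap.compL ℂ K (H ⊗[ℂ] K) (HTensor H K)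
    (incl H K).toContinuousLinearMap) ∘L TensorProduct.mkL ℂ H K

@[simp] lemma mkL_apply (x : H) (y : K) : mkL H K x y = tmul x y := rfl

lemma incl_mem_of_tmul_mem (S : Submodule ℂ (HTensor H K)) (h : ∀ x y, tmul x y ∈ S)
    (z : H ⊗[ℂ] K) : incl H K z ∈ S := by
  induction z with
  | zero => simp
  | tmul x y => exact h x y
  | add a b ha hb => rw [map_add]; exact S.add_mem ha hb

/-- A closed subspace that contains all elementary tensors is everything. -/
lemma mem_of_tmul_mem (S : Submodule ℂ (HTensor H K)) (hS : IsClosed (S : Set (HTensor H K)))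
    (h : ∀ x y, tmul x y ∈ S) (z : HTensor H K) : z ∈ S :=
  denseRange_incl.induction_on (p := fun z => z ∈ S) z hS (incl_mem_of_tmul_mem S h)

lemma ext_tmul {E : Type*} [NormedAddCommGroup E] [NormedSpace ℂ E]
    {f g : HTensor H K →L[ℂ] E} (h : ∀ x y, f (tmul x y) = g (tmul x y)) : f = g := by
  ext z
  have := mem_of_tmul_mem (LinearMap.eqLocus f.toLinearMap g.toLinearMap)
    (isClosed_eq f.continuous g.continuous) h z
  exact this

/-- The operator `T ⊗ S` between Hilbert space tensor products. -/
def map (T : H →L[ℂ] H') (S : K →L[ℂ] K') : HTensor H K →L[ℂ] HTensor H' K' :=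
  ((incl H' K').toLinearMap ∘ₗ (TensorProduct.mapL T S).toLinearMap).extendOfNorm
    (incl H K).toLinearMap

lemma map_bound (T : H →L[ℂ] H') (S : K →L[ℂ] K') (z : H ⊗[ℂ] K) :
    ‖((incl H' K').toLinearMap ∘ₗ (TensorProduct.mapL T S).toLinearMap) z‖ ≤
      (‖T‖ * ‖S‖) * ‖(incl H K).toLinearMap z‖ := by
  have h1 := (TensorProduct.mapL T S).le_opNorm z
  have h2 := TensorProduct.norm_mapL_le T S
  simp only [LinearMap.comp_apply, LinearIsometry.coe_toLinearMap, LinearIsometry.norm_map]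
  exact h1.trans (by gcongr)

lemma map_incl (T : H →L[ℂ] H') (S : K →L[ℂ] K') (z : H ⊗[ℂ] K) :
    map T S (incl H K z) = incl H' K' (TensorProduct.mapL T S z) :=
  LinearMap.extendOfNorm_eq (e := (incl H K).toLinearMap) denseRange_incl ⟨_, map_bound T S⟩ z

@[simp] lemma map_tmul (T : H →L[ℂ] H') (S : K →L[ℂ] K') (x : H) (y : K) :
    map T S (tmul x y) = tmul (T x) (S y) := by
  simp [tmul, map_incl]

lemma norm_map_le (T : H →L[ℂ] H') (S : K →L[ℂ] K') : ‖map T S‖ ≤ ‖T‖ * ‖S‖ :=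
  LinearMap.opNorm_extendOfNorm_le (e := (incl H K).toLinearMap) denseRange_incl (by positivity)
    (map_bound T S)

lemma map_comp (T : H →L[ℂ] H') (S : K →L[ℂ] K') (T' : H' →L[ℂ] H'') (S' : K' →L[ℂ] K'') :
    map T' S' ∘L map T S = map (T' ∘L T) (S' ∘L S) :=
  ext_tmul fun x y => by simp

lemma tmul_add (x : H) (y y' : K) : tmul x (y + y') = tmul x y + tmul x y' :=
  map_add (mkL H K x) y y'
lemma add_tmul (x x' : H) (y : K) : tmul (x + x') y = tmul x y + tmul x' y :=
  congr($(map_add (mkL H K) x x') y)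
lemma tmul_smul (c : ℂ) (x : H) (y : K) : tmul x (c • y) = c • tmul x y :=
  map_smul (mkL H K x) c y
lemma smul_tmul (c : ℂ) (x : H) (y : K) : tmul (c • x) y = c • tmul x y :=
  congr($(map_smul (mkL H K) c x) y)

lemma ext_inner {z w : HTensor H K}
    (h : ∀ x y, inner ℂ z (tmul x y) = inner ℂ w (tmul x y)) : z = w := by
  have : innerSL ℂ z = innerSL ℂ w := ext_tmul fun x y => by simpa using h x y
  exact ext_inner_right ℂ fun v => by simpa using congr($this v)

lemma adjoint_map [CompleteSpace H] [CompleteSpace K] [CompleteSpace H'] [CompleteSpace K']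
    (T : H →L[ℂ] H') (S : K →L[ℂ] K') :
    (map T S).adjoint = map T.adjoint S.adjoint := by
  refine ext_tmul fun x' y' => ext_inner fun x y => ?_
  simp [ContinuousLinearMap.adjoint_inner_left, inner_tmul]

lemma map_add_left (T T' : H →L[ℂ] H') (S : K →L[ℂ] K') :
    map (T + T') S = map T S + map T' S :=
  ext_tmul fun x y => by simp [add_tmul]
lemma map_add_right (T : H →L[ℂ] H') (S S' : K →L[ℂ] K') :
    map T (S + S') = map T S + map T S' :=
  ext_tmul fun x y => by simp [tmul_add]
lemma map_smul_left (c : ℂ) (T : H →L[ℂ] H') (S : K →L[ℂ] K') :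
    map (c • T) S = c • map T S :=
  ext_tmul fun x y => by simp [smul_tmul]
lemma map_smul_right (c : ℂ) (T : H →L[ℂ] H') (S : K →L[ℂ] K') :
    map T (c • S) = c • map T S :=
  ext_tmul fun x y => by simp [tmul_smul]

/-- `V ⊗ U` for linear isometries `V` and `U`. -/
def mapIsometry (V : H →ₗᵢ[ℂ] H') (U : K →ₗᵢ[ℂ] K') : HTensor H K →ₗᵢ[ℂ] HTensor H' K' where
  toLinearMap := (map V.toContinuousLinearMap U.toContinuousLinearMap).toLinearMap
  norm_map' z := by
    refine denseRange_incl.induction_on (p := fun z => ‖map V.toContinuousLinearMap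
      U.toContinuousLinearMap z‖ = ‖z‖) z (isClosed_eq (by fun_prop) (by fun_prop)) fun w => ?_
    rw [map_incl, LinearIsometry.norm_map, LinearIsometry.norm_map]
    rw [← TensorProduct.toContinuousLinearMap_mapIsometry]
    exact (TensorProduct.mapIsometry V U).norm_map w

@[simp] lemma mapIsometry_tmul (V : H →ₗᵢ[ℂ] H') (U : K →ₗᵢ[ℂ] K') (x : H) (y : K) :
    mapIsometry V U (tmul x y) = tmul (V x) (U y) :=
  map_tmul _ _ x y

variable (H K) in
/-- The flip `x ⊗ y ↦ y ⊗ x`. -/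
def comm : HTensor H K ≃ₗᵢ[ℂ] HTensor K H :=
  (TensorProduct.comm ℂ H K).extendOfIsometry (incl H K).toLinearMap (incl K H).toLinearMap
    denseRange_incl denseRange_incl (fun x => by simp)

@[simp] lemma comm_tmul (x : H) (y : K) : comm H K (tmul x y) = tmul y x :=
  (TensorProduct.comm ℂ H K).extendOfIsometry_eq _ _ _ _ _ (x ⊗ₜ[ℂ] y)

lemma denseRange_of_tmul_mem {E : Type*} [AddCommGroup E] [Module ℂ E] (f : E →ₗ[ℂ] HTensor H K)
    (h : ∀ x y, tmul x y ∈ f.range.topologicalClosure) : DenseRange f := fun z =>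
  mem_of_tmul_mem f.range.topologicalClosure f.range.isClosed_topologicalClosure h z

variable (H K L) in
/-- `(x ⊗ y) ⊗ z ↦ x ⊗ (y ⊗ z)`. -/
def assoc : HTensor (HTensor H K) L ≃ₗᵢ[ℂ] HTensor H (HTensor K L) :=
  (TensorProduct.assoc ℂ H K L).extendOfIsometry
    ((incl (HTensor H K) L).toLinearMap ∘ₗ ((incl H K).rTensor L).toLinearMap)
    ((incl H (HTensor K L)).toLinearMap ∘ₗ ((incl K L).lTensor H).toLinearMap)
    (denseRange_of_tmul_mem _ fun w z => by
      let R := ((incl (HTensor H K) L).toLinearMap ∘ₗ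
        ((incl H K).rTensor L).toLinearMap).range.topologicalClosure
      refine mem_of_tmul_mem (R.comap ((mkL (HTensor H K) L).flip z).toLinearMap)
        ((Submodule.isClosed_topologicalClosure _).preimage ((mkL (HTensor H K) L).flip z).continuous)
        (fun x y => ?_) w
      exact Submodule.le_topologicalClosure _ ⟨(x ⊗ₜ[ℂ] y) ⊗ₜ[ℂ] z, rfl⟩)
    (denseRange_of_tmul_mem _ fun x w => by
      let R := ((incl H (HTensor K L)).toLinearMap ∘ₗ
        ((incl K L).lTensor H).toLinearMap).range.topologicalClosure
      refine mem_of_tmul_mem (R.comap (mkL H (HTensor K L) x).toLinearMap)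
        ((Submodule.isClosed_topologicalClosure _).preimage (mkL H (HTensor K L) x).continuous)
        (fun y z => ?_) w
      exact Submodule.le_topologicalClosure _ ⟨x ⊗ₜ[ℂ] (y ⊗ₜ[ℂ] z), rfl⟩)
    (fun x => by
      simp only [LinearMap.comp_apply, LinearIsometry.coe_toLinearMap, LinearIsometry.norm_map]
      exact TensorProduct.norm_assoc x)

@[simp] lemma assoc_tmul (x : H) (y : K) (z : L) :
    assoc H K L (tmul (tmul x y) z) = tmul x (tmul y z) :=
  (TensorProduct.assoc ℂ H K L).extendOfIsometry_eq _ _ _ _ _ ((x ⊗ₜ[ℂ] y) ⊗ₜ[ℂ] z)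

@[simp] lemma assoc_symm_tmul (x : H) (y : K) (z : L) :
    (assoc H K L).symm (tmul x (tmul y z)) = tmul (tmul x y) z := by
  rw [LinearIsometryEquiv.symm_apply_eq, assoc_tmul]

/-! Leg numbering on the threefold tensor product, bracketed as `(H ⊗ K) ⊗ L`. -/

variable {L' : Type*} [NormedAddCommGroup L'] [InnerProductSpace ℂ L']

variable (L) in
/-- `T₁₂ = T ⊗ I`. -/
def leg12 (T : HTensor H K →L[ℂ] HTensor H' K') :
    HTensor (HTensor H K) L →L[ℂ] HTensor (HTensor H' K') L :=
  map T (ContinuousLinearMap.id ℂ L)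

variable (H) in
/-- `T₂₃ = I ⊗ T`. -/
def leg23 (T : HTensor K L →L[ℂ] HTensor K' L') :
    HTensor (HTensor H K) L →L[ℂ] HTensor (HTensor H K') L' :=
  (assoc H K' L').symm.toContinuousLinearEquiv.toContinuousLinearMap ∘L
    map (ContinuousLinearMap.id ℂ H) T ∘L
    (assoc H K L).toContinuousLinearEquiv.toContinuousLinearMap

variable (H K L) in
/-- The flip `τ₂₃` of the second and the third leg, `x ⊗ y ⊗ z ↦ x ⊗ z ⊗ y`. -/
def flip23 : HTensor (HTensor H K) L →L[ℂ] HTensor (HTensor H L) K :=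
  leg23 H (comm K L).toContinuousLinearEquiv.toContinuousLinearMap

variable (K) in
/-- `T₁₃ = τ₂₃⁻¹ (T ⊗ I) τ₂₃`. -/
def leg13 (T : HTensor H L →L[ℂ] HTensor H' L') :
    HTensor (HTensor H K) L →L[ℂ] HTensor (HTensor H' K) L' :=
  flip23 H' L' K ∘L leg12 K T ∘L flip23 H K L

lemma flip23_tmul (x : H) (y : K) (z : L) :
    flip23 H K L (tmul (tmul x y) z) = tmul (tmul x z) y := by
  simp [flip23, leg23]

end HTensor
end HilbertTensor

/-! ### Operators between Hilbert space direct sums -/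

section DirectSumOperators

variable {ι κ : Type*} {G F : ι → Type*}
  [∀ i, NormedAddCommGroup (G i)] [∀ i, InnerProductSpace ℂ (G i)]
  [∀ i, NormedAddCommGroup (F i)] [∀ i, InnerProductSpace ℂ (F i)]

lemma diag_bound (T : ∀ i, G i →L[ℂ] F i) (C : ℝ) (hT : ∀ i, ‖T i‖ ≤ C) (x : lp G 2) :
    Memℓp (fun i => T i (x i)) 2 := by
  refine (lp.memℓp ((C : ℂ) • x)).mono' fun i => ?_
  have h1 := (T i).le_of_opNorm_le (hT i) (x i)
  rw [lp.coeFn_smul, Pi.smul_apply, norm_smul, Complex.norm_real]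
  exact h1.trans (by gcongr; exact le_abs_self C)

/-- The direct sum `⊕ T_i : ⊕ G_i → ⊕ F_i` of a bounded family of operators. -/
def diag (T : ∀ i, G i →L[ℂ] F i) (C : ℝ) (hT : ∀ i, ‖T i‖ ≤ C) : lp G 2 →L[ℂ] lp F 2 :=
  LinearMap.mkContinuous
    { toFun := fun x => ⟨fun i => T i (x i), diag_bound T C hT x⟩
      map_add' := fun x y => by ext i; simp; rfl
      map_smul' := fun c x => by ext i; simp }
    |C| (fun x => by
      have : ‖(C : ℂ) • x‖ = |C| * ‖x‖ := by rw [norm_smul, Complex.norm_real]; rfl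
      rw [← this]
      refine lp.norm_mono (by norm_num) fun i => ?_
      rw [lp.coeFn_smul, Pi.smul_apply, norm_smul, Complex.norm_real]
      exact ((T i).le_of_opNorm_le (hT i) (x i)).trans (by gcongr; exact le_abs_self C))

@[simp] lemma diag_apply (T : ∀ i, G i →L[ℂ] F i) (C : ℝ) (hT : ∀ i, ‖T i‖ ≤ C) (x : lp G 2)
    (i : ι) : diag T C hT x i = T i (x i) := rfl

/-- For an injective `f : κ → ι`, the coisometry `⊕_i G_i → ⊕_k G_{f k}`, `x ↦ (x_{f k})_k`. -/
def pick (f : κ → ι) (hf : Function.Injective f) : lp G 2 →L[ℂ] lp (fun k => G (f k)) 2 :=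
  LinearMap.mkContinuous
    { toFun := fun x => ⟨fun k => x (f k), memℓp_gen
        (((lp.memℓp x).summable (by norm_num)).comp_injective hf)⟩
      map_add' := fun x y => by ext i; simp; rfl
      map_smul' := fun c x => by ext i; simp }
    1 (fun x => by
      rw [one_mul]
      refine lp.norm_le_of_tsum_le (by norm_num) (norm_nonneg _) ?_
      rw [lp.norm_rpow_eq_tsum (by norm_num) x]
      exact tsum_comp_le_tsum_of_inj ((lp.memℓp x).summable (by norm_num))
        (fun i => by positivity) hf)

@[simp] lemma pick_apply (f : κ → ι) (hf : Function.Injective f) (x : lp G 2) (k : κ) :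
    pick f hf x k = x (f k) := rfl

open scoped Classical in
/-- The inclusion of a direct summand. -/
def summand (i : ι) : G i →ₗᵢ[ℂ] lp G 2 where
  toLinearMap := lp.lsingle 2 i
  norm_map' x := lp.norm_single (by norm_num) i x

end DirectSumOperators

/-! ### The minimal tensor product of C⋆-algebras -/

section MinTensor

/-- The representation `a ⊗ b ↦ π(a) ⊗ ρ(b)` of the algebraic tensor product. -/
def algRep {A B : Type*} [NonUnitalCStarAlgebra A] [NonUnitalCStarAlgebra B]
    {H K : Type*} [NormedAddCommGroup H] [InnerProductSpace ℂ H] [CompleteSpace H]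
    [NormedAddCommGroup K] [InnerProductSpace ℂ K] [CompleteSpace K]
    (π : A →⋆ₙₐ[ℂ] (H →L[ℂ] H)) (ρ : B →⋆ₙₐ[ℂ] (K →L[ℂ] K)) :
    A ⊗[ℂ] B →ₗ[ℂ] (HTensor H K →L[ℂ] HTensor H K) :=
  TensorProduct.lift (LinearMap.mk₂ ℂ (fun a b => HTensor.map (π a) (ρ b))
    (fun a a' b => by rw [map_add, HTensor.map_add_left])
    (fun c a b => by rw [map_smul, HTensor.map_smul_left])
    (fun a b b' => by rw [map_add, HTensor.map_add_right])
    (fun c a b => by rw [map_smul, HTensor.map_smul_right]))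

section algRep

variable {A B : Type*} [NonUnitalCStarAlgebra A] [NonUnitalCStarAlgebra B]
    {H K : Type*} [NormedAddCommGroup H] [InnerProductSpace ℂ H] [CompleteSpace H]
    [NormedAddCommGroup K] [InnerProductSpace ℂ K] [CompleteSpace K]
    (π : A →⋆ₙₐ[ℂ] (H →L[ℂ] H)) (ρ : B →⋆ₙₐ[ℂ] (K →L[ℂ] K))

@[simp] lemma algRep_tmul (a : A) (b : B) :
    algRep π ρ (a ⊗ₜ[ℂ] b) = HTensor.map (π a) (ρ b) := rfl

lemma algRep_mul (x y : A ⊗[ℂ] B) : algRep π ρ (x * y) = algRep π ρ x * algRep π ρ y := by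
  induction x with
  | zero => simp
  | add x x' h h' => rw [add_mul, map_add, map_add, h, h', add_mul]
  | tmul a b =>
    induction y with
    | zero => simp
    | add x x' h h' => rw [mul_add, map_add, map_add, h, h', mul_add]
    | tmul a' b' =>
      rw [Algebra.TensorProduct.tmul_mul_tmul, algRep_tmul, algRep_tmul, algRep_tmul, map_mul,
        map_mul]
      exact (HTensor.map_comp _ _ _ _).symm

lemma algRep_star (x : A ⊗[ℂ] B) : algRep π ρ (star x) = star (algRep π ρ x) := by
  induction x with
  | zero => simp
  | add x x' h h' => rw [star_add, map_add, map_add, h, h', star_add]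
  | tmul a b =>
    rw [TensorProduct.star_tmul, algRep_tmul, algRep_tmul, map_star, map_star]
    exact (HTensor.adjoint_map _ _).symm

lemma algRep_bound (x : A ⊗[ℂ] B) : ∃ C : ℝ, ∀ (H K : Type u)
    [NormedAddCommGroup H] [InnerProductSpace ℂ H] [CompleteSpace H]
    [NormedAddCommGroup K] [InnerProductSpace ℂ K] [CompleteSpace K]
    (π : A →⋆ₙₐ[ℂ] (H →L[ℂ] H)) (ρ : B →⋆ₙₐ[ℂ] (K →L[ℂ] K)), ‖algRep π ρ x‖ ≤ C := by
  induction x with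
  | zero => exact ⟨0, fun H K => by simp⟩
  | add x y h h' =>
    obtain ⟨C, hC⟩ := h
    obtain ⟨D, hD⟩ := h'
    refine ⟨C + D, fun H K _ _ _ _ _ _ π ρ => ?_⟩
    rw [map_add]
    exact (norm_add_le _ _).trans (add_le_add (hC H K π ρ) (hD H K π ρ))
  | tmul a b =>
    refine ⟨‖a‖ * ‖b‖, fun H K _ _ _ _ _ _ π ρ => ?_⟩
    rw [algRep_tmul]
    refine (HTensor.norm_map_le _ _).trans ?_
    gcongr <;> exact NonUnitalStarAlgHom.norm_apply_le _ _

end algRep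

/-- A pair of `*`-representations of `A` and `B` on Hilbert spaces. -/
structure RepPair (A B : Type u) [NonUnitalCStarAlgebra A] [NonUnitalCStarAlgebra B] :
    Type (u + 1) where
  (H K : Type u)
  [nH : NormedAddCommGroup H] [iH : InnerProductSpace ℂ H] [cH : CompleteSpace H]
  [nK : NormedAddCommGroup K] [iK : InnerProductSpace ℂ K] [cK : CompleteSpace K]
  left : A →⋆ₙₐ[ℂ] (H →L[ℂ] H)
  right : B →⋆ₙₐ[ℂ] (K →L[ℂ] K)

attribute [instance] RepPair.nH RepPair.iH RepPair.cH RepPair.nK RepPair.iK RepPair.cK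

variable (A B : Type u) [NonUnitalCStarAlgebra A] [NonUnitalCStarAlgebra B]

instance : Nonempty (RepPair A B) :=
  ⟨{ H := EuclideanSpace ℂ PEmpty.{u + 1}, K := EuclideanSpace ℂ PEmpty.{u + 1}
     left := 0, right := 0 }⟩

variable {A B}

/-- The operator `(π ⊗ ρ)(x)`. -/
def RepPair.op (r : RepPair A B) : A ⊗[ℂ] B →ₗ[ℂ] (HTensor r.H r.K →L[ℂ] HTensor r.H r.K) :=
  algRep r.left r.right

/-- The minimal C⋆-norm on the algebraic tensor product:
`‖x‖ = sup { ‖(π ⊗ ρ)(x)‖ : π a *-representation of A, ρ a *-representation of B }`. -/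
def minNorm (x : A ⊗[ℂ] B) : ℝ := ⨆ r : RepPair A B, ‖r.op x‖

lemma bddAbove_op (x : A ⊗[ℂ] B) : BddAbove (Set.range fun r : RepPair A B => ‖r.op x‖) := by
  obtain ⟨C, hC⟩ := algRep_bound.{u} x
  exact ⟨C, by rintro _ ⟨r, rfl⟩; exact hC r.H r.K r.left r.right⟩

lemma norm_op_le (r : RepPair A B) (x : A ⊗[ℂ] B) : ‖r.op x‖ ≤ minNorm x :=
  le_ciSup (bddAbove_op x) r

lemma minNorm_nonneg (x : A ⊗[ℂ] B) : 0 ≤ minNorm x :=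
  Real.iSup_nonneg fun _ => norm_nonneg _

lemma exists_normingPair (p : (A ⊗[ℂ] B) × ℕ) :
    ∃ r : RepPair A B, minNorm p.1 - 1 / (p.2 + 1) < ‖r.op p.1‖ :=
  exists_lt_of_lt_ciSup (show minNorm p.1 - 1 / (p.2 + 1 : ℝ) < ⨆ r : RepPair A B, ‖r.op p.1‖ from
    sub_lt_self _ (by positivity))

/-- A set-sized family of pairs of representations that computes the minimal norm. -/
def normingPair (p : (A ⊗[ℂ] B) × ℕ) : RepPair A B := (exists_normingPair p).choose

variable (A B) in
/-- The C⋆-algebra in which the minimal tensor product is formed as a closure: the `ℓ^∞`-product of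
the operator algebras of the norming pairs. -/
def Ambient : Type u :=
  lp (fun p : (A ⊗[ℂ] B) × ℕ => HTensor (normingPair p).H (normingPair p).K →L[ℂ]
    HTensor (normingPair p).H (normingPair p).K) ∞

instance : NonUnitalCStarAlgebra (Ambient A B) :=
  inferInstanceAs (NonUnitalCStarAlgebra (lp (fun p : (A ⊗[ℂ] B) × ℕ =>
    HTensor (normingPair p).H (normingPair p).K →L[ℂ]
      HTensor (normingPair p).H (normingPair p).K) ∞))

variable (A B) in
/-- The algebraic tensor product inside `Ambient A B`. -/
def ambientIncl : A ⊗[ℂ] B →ₗ[ℂ] Ambient A B where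
  toFun x := ⟨fun p => (normingPair p).op x, memℓp_infty
    ⟨minNorm x, by rintro _ ⟨p, rfl⟩; exact norm_op_le _ x⟩⟩
  map_add' x y := by refine lp.ext (funext fun p => ?_); exact map_add _ x y
  map_smul' c x := by refine lp.ext (funext fun p => ?_); exact map_smul _ c x

lemma norm_ambientIncl (x : A ⊗[ℂ] B) : ‖ambientIncl A B x‖ = minNorm x := by
  refine le_antisymm (lp.norm_le_of_forall_le (minNorm_nonneg x) fun p => norm_op_le _ x) ?_
  refine le_of_forall_pos_lt_add fun ε hε => ?_
  obtain ⟨n, hn⟩ := exists_nat_one_div_lt hε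
  have h1 : minNorm x - 1 / (n + 1) < ‖(normingPair (x, n)).op x‖ :=
    (exists_normingPair (x, n)).choose_spec
  have h2 : ‖(normingPair (x, n)).op x‖ ≤ ‖ambientIncl A B x‖ :=
    lp.norm_apply_le_norm (by norm_num) (ambientIncl A B x) (x, n)
  linarith

lemma ambientIncl_mul (x y : A ⊗[ℂ] B) :
    ambientIncl A B (x * y) = ambientIncl A B x * ambientIncl A B y := by
  refine lp.ext (funext fun p => ?_); exact algRep_mul _ _ x y

lemma ambientIncl_star (x : A ⊗[ℂ] B) :
    ambientIncl A B (star x) = star (ambientIncl A B x) := by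
  refine lp.ext (funext fun p => ?_); exact algRep_star _ _ x

variable (A B) in
/-- The image of the algebraic tensor product, as a `*`-subalgebra. -/
def algImage : NonUnitalStarSubalgebra ℂ (Ambient A B) where
  carrier := Set.range (ambientIncl A B)
  zero_mem' := ⟨0, map_zero _⟩
  add_mem' := by rintro _ _ ⟨x, rfl⟩ ⟨y, rfl⟩; exact ⟨x + y, map_add _ x y⟩
  mul_mem' := by rintro _ _ ⟨x, rfl⟩ ⟨y, rfl⟩; exact ⟨x * y, ambientIncl_mul x y⟩
  smul_mem' := by rintro c _ ⟨x, rfl⟩; exact ⟨c • x, map_smul _ c x⟩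
  star_mem' := by rintro _ ⟨x, rfl⟩; exact ⟨star x, ambientIncl_star x⟩

variable (A B) in
/-- The minimal C⋆-tensor product `A ⊗ B`: the completion of the algebraic tensor product in the
minimal norm, realized as a norm closure. -/
def MinTensor : Type u := (algImage A B).topologicalClosure

instance : NonUnitalCStarAlgebra (MinTensor A B) :=
  NonUnitalStarSubalgebra.nonUnitalCStarAlgebra (algImage A B).topologicalClosure
    (h_closed := NonUnitalStarSubalgebra.isClosed_topologicalClosure _)

namespace MinTensor

variable (A B) in
/-- The canonical map from the algebraic tensor product. -/
def incl : A ⊗[ℂ] B →ₗ[ℂ] MinTensor A B where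
  toFun x := ⟨ambientIncl A B x, NonUnitalStarSubalgebra.le_topologicalClosure _ ⟨x, rfl⟩⟩
  map_add' x y := Subtype.ext (map_add _ x y)
  map_smul' c x := Subtype.ext (map_smul _ c x)

lemma norm_incl (x : A ⊗[ℂ] B) : ‖incl A B x‖ = minNorm x := norm_ambientIncl x

lemma incl_mul (x y : A ⊗[ℂ] B) : incl A B (x * y) = incl A B x * incl A B y :=
  Subtype.ext (ambientIncl_mul x y)

lemma incl_star (x : A ⊗[ℂ] B) : incl A B (star x) = star (incl A B x) :=
  Subtype.ext (ambientIncl_star x)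

lemma denseRange_incl : DenseRange (incl A B) := by
  rintro ⟨z, hz⟩
  refine closure_subtype.2 ?_
  refine closure_mono ?_ hz
  rintro _ ⟨x, rfl⟩
  exact ⟨incl A B x, ⟨x, rfl⟩, rfl⟩

/-- The elementary tensor `a ⊗ b`. -/
def tmul (a : A) (b : B) : MinTensor A B := incl A B (a ⊗ₜ[ℂ] b)

lemma tmul_mul_tmul (a a' : A) (b b' : B) :
    tmul a b * tmul a' b' = tmul (a * a') (b * b') := by
  rw [tmul, tmul, ← incl_mul, Algebra.TensorProduct.tmul_mul_tmul, tmul]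

lemma star_tmul (a : A) (b : B) : star (tmul a b) = tmul (star a) (star b) := by
  rw [tmul, ← incl_star, TensorProduct.star_tmul, tmul]

lemma incl_mem_of_tmul_mem (S : Submodule ℂ (MinTensor A B)) (h : ∀ x y, tmul x y ∈ S)
    (z : A ⊗[ℂ] B) : incl A B z ∈ S := by
  induction z with
  | zero => simp
  | tmul x y => exact h x y
  | add a b ha hb => rw [map_add]; exact S.add_mem ha hb

/-- A closed subspace that contains all elementary tensors is everything. -/
lemma mem_of_tmul_mem (S : Submodule ℂ (MinTensor A B)) (hS : IsClosed (S : Set (MinTensor A B)))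
    (h : ∀ x y, tmul x y ∈ S) (z : MinTensor A B) : z ∈ S :=
  denseRange_incl.induction_on (p := fun z => z ∈ S) z hS (incl_mem_of_tmul_mem S h)

lemma eq_of_tmul {E : Type*} [NormedAddCommGroup E] [NormedSpace ℂ E]
    {f g : MinTensor A B →ₗ[ℂ] E} (hf : Continuous f) (hg : Continuous g)
    (h : ∀ x y, f (tmul x y) = g (tmul x y)) (z : MinTensor A B) : f z = g z :=
  mem_of_tmul_mem (LinearMap.eqLocus f g) (isClosed_eq hf hg) h z

/-- A `*`-homomorphism on the algebraic tensor product that is contractive for the minimal norm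
extends to the minimal tensor product. -/
def lift {D : Type*} [NonUnitalCStarAlgebra D] (θ : A ⊗[ℂ] B →ₗ[ℂ] D)
    (hmul : ∀ x y, θ (x * y) = θ x * θ y) (hstar : ∀ x, θ (star x) = star (θ x))
    (hnorm : ∀ x, ‖θ x‖ ≤ minNorm x) : MinTensor A B →⋆ₙₐ[ℂ] D :=
  have hn : ∃ C : ℝ, ∀ x, ‖θ x‖ ≤ C * ‖incl A B x‖ := ⟨1, fun x => by
    rw [one_mul, norm_incl]; exact hnorm x⟩
  have hi : ∀ x, θ.extendOfNorm (incl A B) (incl A B x) = θ x :=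
    LinearMap.extendOfNorm_eq denseRange_incl hn
  { toFun := θ.extendOfNorm (incl A B)
    map_smul' := fun c x => map_smul _ c x
    map_zero' := map_zero _
    map_add' := fun x y => map_add _ x y
    map_mul' := fun x y => by
      refine denseRange_incl.induction_on₂ (p := fun x y => θ.extendOfNorm (incl A B) (x * y) =
        θ.extendOfNorm (incl A B) x * θ.extendOfNorm (incl A B) y)
        (isClosed_eq (by fun_prop) (by fun_prop)) (fun x y => ?_) x y
      rw [← incl_mul, hi, hi, hi, hmul]
    map_star' := fun x => by
      refine denseRange_incl.induction_on (p := fun x => θ.extendOfNorm (incl A B) (star x) =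
        star (θ.extendOfNorm (incl A B) x)) x
        (isClosed_eq (by fun_prop) (by fun_prop)) (fun x => ?_)
      rw [← incl_star, hi, hi, hstar] }

lemma lift_incl {D : Type*} [NonUnitalCStarAlgebra D] (θ : A ⊗[ℂ] B →ₗ[ℂ] D)
    (hmul : ∀ x y, θ (x * y) = θ x * θ y) (hstar : ∀ x, θ (star x) = star (θ x))
    (hnorm : ∀ x, ‖θ x‖ ≤ minNorm x) (x : A ⊗[ℂ] B) :
    lift θ hmul hstar hnorm (incl A B x) = θ x :=
  LinearMap.extendOfNorm_eq denseRange_incl ⟨1, fun x => by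
    rw [one_mul, norm_incl]; exact hnorm x⟩ x

/-- The representation `π ⊗ ρ` of `A ⊗ B` on `H ⊗ K`. -/
def prodRep {H K : Type u} [NormedAddCommGroup H] [InnerProductSpace ℂ H] [CompleteSpace H]
    [NormedAddCommGroup K] [InnerProductSpace ℂ K] [CompleteSpace K]
    (π : A →⋆ₙₐ[ℂ] (H →L[ℂ] H)) (ρ : B →⋆ₙₐ[ℂ] (K →L[ℂ] K)) :
    MinTensor A B →⋆ₙₐ[ℂ] (HTensor H K →L[ℂ] HTensor H K) :=
  lift (algRep π ρ) (algRep_mul π ρ) (algRep_star π ρ)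
    (norm_op_le { H := H, K := K, left := π, right := ρ })

@[simp] lemma prodRep_tmul {H K : Type u} [NormedAddCommGroup H] [InnerProductSpace ℂ H]
    [CompleteSpace H] [NormedAddCommGroup K] [InnerProductSpace ℂ K] [CompleteSpace K]
    (π : A →⋆ₙₐ[ℂ] (H →L[ℂ] H)) (ρ : B →⋆ₙₐ[ℂ] (K →L[ℂ] K)) (a : A) (b : B) :
    prodRep π ρ (tmul a b) = HTensor.map (π a) (ρ b) :=
  lift_incl _ _ _ _ _

variable {A' B' : Type u} [NonUnitalCStarAlgebra A'] [NonUnitalCStarAlgebra B']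

/-- The algebraic `f ⊗ g`. -/
def algMap (f : A →⋆ₙₐ[ℂ] A') (g : B →⋆ₙₐ[ℂ] B') : A ⊗[ℂ] B →ₗ[ℂ] A' ⊗[ℂ] B' :=
  TensorProduct.map (f : A →ₗ[ℂ] A') (g : B →ₗ[ℂ] B')

lemma algMap_mul (f : A →⋆ₙₐ[ℂ] A') (g : B →⋆ₙₐ[ℂ] B') (x y : A ⊗[ℂ] B) :
    algMap f g (x * y) = algMap f g x * algMap f g y := by
  induction x with
  | zero => simp
  | add x x' h h' => rw [add_mul, map_add, map_add, h, h', add_mul]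
  | tmul a b =>
    induction y with
    | zero => simp
    | add x x' h h' => rw [mul_add, map_add, map_add, h, h', mul_add]
    | tmul a' b' => simp [algMap]

lemma algMap_star (f : A →⋆ₙₐ[ℂ] A') (g : B →⋆ₙₐ[ℂ] B') (x : A ⊗[ℂ] B) :
    algMap f g (star x) = star (algMap f g x) := by
  induction x with
  | zero => simp
  | add x x' h h' => rw [star_add, map_add, map_add, h, h', star_add]
  | tmul a b => simp [algMap, map_star]

lemma minNorm_algMap_le (f : A →⋆ₙₐ[ℂ] A') (g : B →⋆ₙₐ[ℂ] B') (x : A ⊗[ℂ] B) :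
    minNorm (algMap f g x) ≤ minNorm x := by
  refine ciSup_le fun r => ?_
  let s : RepPair A B := { H := r.H, K := r.K, left := r.left.comp f, right := r.right.comp g }
  have : r.op (algMap f g x) = s.op x := by
    induction x with
    | zero => simp
    | add x x' h h' => rw [map_add, map_add, map_add, h, h']
    | tmul a b => rfl
  rw [this]
  exact norm_op_le s x

/-- The `*`-homomorphism `f ⊗ g : A ⊗ B → A' ⊗ B'`. -/
def map (f : A →⋆ₙₐ[ℂ] A') (g : B →⋆ₙₐ[ℂ] B') : MinTensor A B →⋆ₙₐ[ℂ] MinTensor A' B' :=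
  lift (incl A' B' ∘ₗ algMap f g)
    (fun x y => by simp [algMap_mul, incl_mul])
    (fun x => by simp [algMap_star, incl_star])
    (fun x => by simpa [norm_incl] using minNorm_algMap_le f g x)

@[simp] lemma map_tmul (f : A →⋆ₙₐ[ℂ] A') (g : B →⋆ₙₐ[ℂ] B') (a : A) (b : B) :
    map f g (tmul a b) = tmul (f a) (g b) :=
  lift_incl _ _ _ _ _

end MinTensor

end MinTensor

/-! ### The `c₀`-direct sum of C⋆-algebras -/

section C0Sum

variable {ι : Type u} (A : ι → Type u) [∀ a, NonUnitalCStarAlgebra (A a)]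

/-- The bounded families `(x_a)` with `‖x_a‖ → 0` (along the complements of finite sets). -/
def c0Subalgebra : NonUnitalStarSubalgebra ℂ (lp A ∞) where
  carrier := {x | Filter.Tendsto (fun a => ‖x a‖) Filter.cofinite (𝓝 0)}
  zero_mem' := by simpa using tendsto_const_nhds
  add_mem' {x y} hx hy := by
    refine squeeze_zero (fun a => norm_nonneg _) (fun a => norm_add_le (x a) (y a)) ?_
    simpa using Filter.Tendsto.add hx hy
  mul_mem' {x y} hx hy := by
    refine squeeze_zero (fun a => norm_nonneg _) (fun a => norm_mul_le (x a) (y a)) ?_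
    simpa using Filter.Tendsto.mul hx hy
  smul_mem' c x hx := by
    have := Filter.Tendsto.const_mul ‖c‖ hx
    simp only [mul_zero] at this
    refine this.congr fun a => ?_
    rw [lp.coeFn_smul, Pi.smul_apply, norm_smul]
  star_mem' {x} hx := by
    refine Filter.Tendsto.congr (fun a => ?_) hx
    rw [lp.star_apply, norm_star]

lemma isClosed_c0Subalgebra : IsClosed (c0Subalgebra A : Set (lp A ∞)) := by
  refine isClosed_of_closure_subset fun x hx => ?_
  refine Metric.tendsto_nhds.2 fun ε hε => ?_
  obtain ⟨y, hy, hxy⟩ := Metric.mem_closure_iff.1 hx (ε / 2) (half_pos hε)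
  have hy' : Filter.Tendsto (fun a => ‖y a‖) Filter.cofinite (𝓝 0) := hy
  filter_upwards [Metric.tendsto_nhds.1 hy' (ε / 2) (half_pos hε)] with a ha
  rw [dist_zero_right, norm_norm] at ha ⊢
  have h1 : ‖x a - y a‖ ≤ ‖x - y‖ := lp.norm_apply_le_norm (by norm_num) (x - y) a
  rw [dist_eq_norm] at hxy
  have h2 : ‖x a‖ ≤ ‖x a - y a‖ + ‖y a‖ := by simpa using norm_add_le (x a - y a) (y a)
  linarith

/-- The C⋆-algebraic direct sum `⊕ A_a = {(x_a) : ‖x_a‖ → 0}`, with the supremum norm. -/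
def C0Sum : Type u := c0Subalgebra A

instance : NonUnitalCStarAlgebra (C0Sum A) :=
  NonUnitalStarSubalgebra.nonUnitalCStarAlgebra (c0Subalgebra A)
    (h_closed := isClosed_c0Subalgebra A)

namespace C0Sum

/-- The coordinate `x ↦ x_a`. -/
def coord (a : ι) : C0Sum A →⋆ₙₐ[ℂ] A a where
  toFun x := x.1 a
  map_smul' _ _ := rfl
  map_zero' := rfl
  map_add' _ _ := rfl
  map_mul' _ _ := rfl
  map_star' _ := rfl

variable {A} in
lemma ext_coord {x y : C0Sum A} (h : ∀ a, coord A a x = coord A a y) : x = y :=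
  Subtype.ext (lp.ext (funext h))

variable {A} in
lemma norm_le {x : C0Sum A} {C : ℝ} (hC : 0 ≤ C) (h : ∀ a, ‖coord A a x‖ ≤ C) : ‖x‖ ≤ C :=
  lp.norm_le_of_forall_le hC h

variable {A} in
lemma tendsto_coord (x : C0Sum A) :
    Filter.Tendsto (fun a => ‖coord A a x‖) Filter.cofinite (𝓝 0) := x.2

open scoped Classical

/-- The inclusion `A_a → ⊕ A_a` of a direct summand. -/
def incl (a : ι) : A a →⋆ₙₐ[ℂ] C0Sum A where
  toFun x := ⟨lp.single ∞ a x, by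
    refine tendsto_const_nhds.congr' ?_
    have : ∀ᶠ b in Filter.cofinite, b ≠ a := (Set.finite_singleton a).compl_mem_cofinite
    filter_upwards [this] with b hb
    rw [lp.single_apply_ne _ _ _ hb, norm_zero]⟩
  map_smul' c x := Subtype.ext (lp.single_smul _ _ _ _)
  map_zero' := Subtype.ext (lp.single_zero _ _)
  map_add' x y := Subtype.ext (lp.single_add _ _ _ _)
  map_mul' x y := ext_coord fun b => by
    change (Pi.single a (x * y) : ∀ i, A i) b =
      (Pi.single a x : ∀ i, A i) b * (Pi.single a y : ∀ i, A i) b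
    by_cases h : b = a
    · subst h; simp
    · simp [h]
  map_star' x := ext_coord fun b => by
    change (Pi.single a (star x) : ∀ i, A i) b = star ((Pi.single a x : ∀ i, A i) b)
    by_cases h : b = a
    · subst h; simp
    · simp [h]

@[simp] lemma coord_incl_self (a : ι) (x : A a) : coord A a (incl A a x) = x :=
  lp.single_apply_self (E := A) ∞ _ _

lemma coord_incl_ne {a b : ι} (h : b ≠ a) (x : A a) : coord A b (incl A a x) = 0 :=
  lp.single_apply_ne (E := A) ∞ _ _ h

lemma incl_mul_incl_ne {a b : ι} (h : a ≠ b) (x : A a) (y : A b) :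
    incl A a x * incl A b y = 0 := by
  refine ext_coord fun c => ?_
  rw [map_mul, map_zero]
  by_cases hc : c = a
  · rw [coord_incl_ne A (b := c) (a := b) (by rintro rfl; exact h hc.symm), mul_zero]
  · rw [coord_incl_ne A hc, zero_mul]

lemma coord_sum_incl (s : Finset ι) (x : C0Sum A) (b : ι) :
    coord A b (∑ a ∈ s, incl A a (coord A a x)) = if b ∈ s then coord A b x else 0 := by
  rw [map_sum]
  split_ifs with h
  · rw [Finset.sum_eq_single_of_mem b h fun a _ hab => coord_incl_ne A hab.symm _,
      coord_incl_self]
  · exact Finset.sum_eq_zero fun a ha => coord_incl_ne A (by rintro rfl; exact h ha) _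

/-- Every element is the norm-convergent sum of its coordinates. -/
lemma hasSum_incl (x : C0Sum A) : HasSum (fun a => incl A a (coord A a x)) x := by
  refine Metric.tendsto_nhds.2 fun ε hε => ?_
  have hfin := Metric.tendsto_nhds.1 (tendsto_coord x) (ε / 2) (half_pos hε)
  rw [Filter.eventually_cofinite] at hfin
  filter_upwards [Filter.eventually_ge_atTop hfin.toFinset] with s hs
  rw [dist_eq_norm]
  refine lt_of_le_of_lt (norm_le (C := ε / 2) (by positivity) fun b => ?_) (half_lt_self hε)
  rw [map_sub, coord_sum_incl]
  split_ifs with h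
  · simp; positivity
  · have : b ∉ hfin.toFinset := fun hb => h (hs hb)
    simp at this
    rw [zero_sub, norm_neg]
    exact this.le

end C0Sum

end C0Sum

/-! ### C⋆-bialgebras -/

section Bialgebra

/-- The graph of the canonical isomorphism `(A ⊗ B) ⊗ C ≅ A ⊗ (B ⊗ C)`, that is, the closed linear
span of the pairs `((a ⊗ b) ⊗ c, a ⊗ (b ⊗ c))`. -/
def assocGraph (A B C : Type u) [NonUnitalCStarAlgebra A] [NonUnitalCStarAlgebra B]
    [NonUnitalCStarAlgebra C] :
    Submodule ℂ (MinTensor (MinTensor A B) C × MinTensor A (MinTensor B C)) :=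
  (Submodule.span ℂ (Set.range fun t : A × B × C =>
    (MinTensor.tmul (MinTensor.tmul t.1 t.2.1) t.2.2,
      MinTensor.tmul t.1 (MinTensor.tmul t.2.1 t.2.2)))).topologicalClosure

/-- A strictly proper C⋆-bialgebra structure on `A`: a `*`-homomorphism `Δ : A → A ⊗ A` with
`span {Δ(a)(b ⊗ c)}` dense in `A ⊗ A` and `(Δ ⊗ id) ∘ Δ = (id ⊗ Δ) ∘ Δ` (as maps into
`(A ⊗ A) ⊗ A ≅ A ⊗ (A ⊗ A)`). -/
structure StrictlyProperBialgebra (A : Type u) [NonUnitalCStarAlgebra A] where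
  /-- the comultiplication `Δ` -/
  comul : A →⋆ₙₐ[ℂ] MinTensor A A
  dense_span : (Submodule.span ℂ (Set.range fun t : A × A × A =>
    comul t.1 * MinTensor.tmul t.2.1 t.2.2)).topologicalClosure = ⊤
  coassoc : ∀ x : A,
    (MinTensor.map comul (NonUnitalStarAlgHom.id ℂ A) (comul x),
      MinTensor.map (NonUnitalStarAlgHom.id ℂ A) comul (comul x)) ∈ assocGraph A A A

/-- The `*`-homomorphism `x ↦ ε(x) 1` from a unital C⋆-algebra to itself. -/
def scalarHom {A : Type u} [CStarAlgebra A] (ε : A →⋆ₙₐ[ℂ] ℂ) : A →⋆ₙₐ[ℂ] A where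
  toFun x := ε x • (1 : A)
  map_smul' c x := by simp [smul_smul]
  map_zero' := by simp
  map_add' x y := by simp [add_smul]
  map_mul' x y := by simp [smul_smul, mul_comm]
  map_star' x := by simp [map_star]

/-- `ε` is a counit: `(ε ⊗ id) ∘ Δ = id = (id ⊗ ε) ∘ Δ`. For a unital C⋆-algebra `A` the
identifications `ℂ ⊗ A ≅ A ≅ A ⊗ ℂ` are made inside `A ⊗ A`, where `A` is `1 ⊗ A` or `A ⊗ 1`. -/
structure IsCounit {A : Type u} [CStarAlgebra A] (Δ : A →⋆ₙₐ[ℂ] MinTensor A A)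
    (ε : A →⋆ₙₐ[ℂ] ℂ) : Prop where
  left : ∀ x, MinTensor.map (scalarHom ε) (NonUnitalStarAlgHom.id ℂ A) (Δ x) = MinTensor.tmul 1 x
  right : ∀ x, MinTensor.map (NonUnitalStarAlgHom.id ℂ A) (scalarHom ε) (Δ x) = MinTensor.tmul x 1

end Bialgebra

/-! ### C⋆-weakly coassociative systems and the associated C⋆-bialgebra -/

/-- Every element of the monoid has only finitely many factorizations into two factors. -/
class FiniteFactorization (M : Type*) [Mul M] : Prop where
  finite : ∀ a : M, Finite {p : M × M // p.1 * p.2 = a}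

/-- `N_a = {(b, c) : b c = a}`. -/
abbrev Factorizations {M : Type*} [Mul M] (a : M) : Type _ := {p : M × M // p.1 * p.2 = a}

instance {M : Type*} [Mul M] [FiniteFactorization M] (a : M) : Fintype (Factorizations a) :=
  @Fintype.ofFinite _ (FiniteFactorization.finite a)

/-- A C⋆-weakly coassociative system over the monoid `M`. The `*`-homomorphism
`φ_{a,b} : A_{ab} → A_a ⊗ A_b` is given as `φ h : A_c → A_a ⊗ A_b` for the proof `h` of `a b = c`,
so that no transport along equations such as `(a b) c = a (b c)` is needed. -/
structure WCS {M : Type u} [Monoid M] (A : M → Type u) [∀ a, CStarAlgebra (A a)] where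
  φ : ∀ {a b c : M}, a * b = c → (A c →⋆ₙₐ[ℂ] MinTensor (A a) (A b))
  φ_one : ∀ {a b c : M} (h : a * b = c), φ h 1 = MinTensor.tmul 1 1
  /-- `(id_a ⊗ φ_{b,c}) ∘ φ_{a,bc} = (φ_{a,b} ⊗ id_c) ∘ φ_{ab,c}` -/
  coassoc : ∀ {a b c ab bc abc : M} (hab : a * b = ab) (hbc : b * c = bc) (h : ab * c = abc)
    (h' : a * bc = abc) (x : A abc),
    (MinTensor.map (φ hab) (NonUnitalStarAlgHom.id ℂ (A c)) (φ h x),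
      MinTensor.map (NonUnitalStarAlgHom.id ℂ (A a)) (φ hbc) (φ h' x)) ∈ assocGraph (A a) (A b) (A c)
  /-- `(A_e, φ_{e,e})` is a counital C⋆-bialgebra -/
  counital : ∃ (B : StrictlyProperBialgebra (A 1)) (ε : A 1 →⋆ₙₐ[ℂ] ℂ),
    B.comul = φ (mul_one 1) ∧ IsCounit B.comul ε
  φ_one_left : ∀ (a : M) (x : A a), φ (one_mul a) x = MinTensor.tmul 1 x
  φ_one_right : ∀ (a : M) (x : A a), φ (mul_one a) x = MinTensor.tmul x 1


section sumHom

variable {κ D E : Type*} [NonUnitalCStarAlgebra D] [NonUnitalCStarAlgebra E]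

/-- A finite sum of `*`-homomorphisms with mutually orthogonal ranges. -/
def sumHom (s : Finset κ) (f : κ → D →⋆ₙₐ[ℂ] E)
    (hf : ∀ i j, i ≠ j → ∀ x y, f i x * f j y = 0) : D →⋆ₙₐ[ℂ] E where
  toFun x := ∑ i ∈ s, f i x
  map_smul' c x := by simp [Finset.smul_sum]
  map_zero' := by simp
  map_add' x y := by simp [Finset.sum_add_distrib]
  map_mul' x y := by
    rw [Finset.sum_mul_sum]
    refine Finset.sum_congr rfl fun i hi => ?_
    rw [Finset.sum_eq_single_of_mem i hi fun j _ hj => hf i j hj.symm x y, map_mul]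
  map_star' x := by simp [star_sum, map_star]

@[simp] lemma sumHom_apply (s : Finset κ) (f : κ → D →⋆ₙₐ[ℂ] E)
    (hf : ∀ i j, i ≠ j → ∀ x y, f i x * f j y = 0) (x : D) :
    sumHom s f hf x = ∑ i ∈ s, f i x := rfl

end sumHom

namespace MinTensor

lemma continuous_hom {D E : Type*} [NonUnitalCStarAlgebra D] [NonUnitalCStarAlgebra E]
    (f : D →⋆ₙₐ[ℂ] E) : Continuous f :=
  AddMonoidHomClass.continuous_of_bound f 1 fun x => by
    rw [one_mul]; exact NonUnitalStarAlgHom.norm_apply_le f x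

variable {A B C A' B' C' : Type u} [NonUnitalCStarAlgebra A] [NonUnitalCStarAlgebra B]
  [NonUnitalCStarAlgebra C]
  [NonUnitalCStarAlgebra A'] [NonUnitalCStarAlgebra B'] [NonUnitalCStarAlgebra C']

lemma add_tmul (a a' : A) (b : B) : tmul (a + a') b = tmul a b + tmul a' b := by
  simp [tmul, TensorProduct.add_tmul]
lemma tmul_add (a : A) (b b' : B) : tmul a (b + b') = tmul a b + tmul a b' := by
  simp [tmul, TensorProduct.tmul_add]
lemma smul_tmul (c : ℂ) (a : A) (b : B) : tmul (c • a) b = c • tmul a b := by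
  rw [tmul, tmul, ← map_smul, TensorProduct.smul_tmul']
lemma tmul_smul (c : ℂ) (a : A) (b : B) : tmul a (c • b) = c • tmul a b := by
  simp [tmul]

lemma norm_tmul_le (a : A) (b : B) : ‖tmul a b‖ ≤ ‖a‖ * ‖b‖ := by
  rw [tmul, norm_incl]
  refine ciSup_le fun r => (HTensor.norm_map_le _ _).trans ?_
  gcongr <;> exact NonUnitalStarAlgHom.norm_apply_le _ _

variable (A B) in
/-- `tmul` as a continuous bilinear map. -/
def mkL : A →L[ℂ] B →L[ℂ] MinTensor A B :=
  (LinearMap.mk₂ ℂ tmul add_tmul smul_tmul tmul_add tmul_smul).mkContinuous₂ 1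
    (fun a b => by rw [one_mul]; exact norm_tmul_le a b)

@[simp] lemma mkL_apply (a : A) (b : B) : mkL A B a b = tmul a b := rfl

lemma hom_ext {D : Type*} [NonUnitalCStarAlgebra D] {f g : MinTensor A B →⋆ₙₐ[ℂ] D}
    (h : ∀ x y, f (tmul x y) = g (tmul x y)) (z : MinTensor A B) : f z = g z :=
  eq_of_tmul (f := (f : MinTensor A B →ₗ[ℂ] D)) (g := (g : MinTensor A B →ₗ[ℂ] D))
    (continuous_hom f) (continuous_hom g) h z

lemma map_map {A'' B'' : Type u} [NonUnitalCStarAlgebra A''] [NonUnitalCStarAlgebra B'']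
    (f' : A' →⋆ₙₐ[ℂ] A'') (g' : B' →⋆ₙₐ[ℂ] B'') (f : A →⋆ₙₐ[ℂ] A') (g : B →⋆ₙₐ[ℂ] B')
    (z : MinTensor A B) : map f' g' (map f g z) = map (f'.comp f) (g'.comp g) z :=
  hom_ext (f := (map f' g').comp (map f g)) (fun x y => by simp) z

lemma map_mul_map_eq_zero_left {A₁ : Type u} [NonUnitalCStarAlgebra A₁]
    {B₁ : Type u} [NonUnitalCStarAlgebra B₁]
    (f : A →⋆ₙₐ[ℂ] A') (g : B →⋆ₙₐ[ℂ] B')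
    (f₁ : A₁ →⋆ₙₐ[ℂ] A') (g₁ : B₁ →⋆ₙₐ[ℂ] B')
    (h : ∀ x y x' y', f x * f₁ x' = 0 ∨ g y * g₁ y' = 0)
    (z : MinTensor A B) (w : MinTensor A₁ B₁) : map f g z * map f₁ g₁ w = 0 := by
  have h1 : ∀ x y, map f g (tmul x y) * map f₁ g₁ w = 0 := fun x y =>
    eq_of_tmul (f := LinearMap.mulLeft ℂ (map f g (tmul x y)) ∘ₗ
        (map f₁ g₁ : MinTensor A₁ B₁ →ₗ[ℂ] MinTensor A' B')) (g := 0)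
      (continuous_const.mul (continuous_hom (map f₁ g₁))) continuous_const (fun x' y' => by
        change map f g (tmul x y) * map f₁ g₁ (tmul x' y') = 0
        rw [map_tmul, map_tmul, tmul_mul_tmul]
        rcases h x y x' y' with h | h
        · rw [h]; exact congr($(map_zero (mkL A' B')) _)
        · rw [h]; exact map_zero (mkL A' B' _)) w
  exact eq_of_tmul (f := LinearMap.mulRight ℂ (map f₁ g₁ w) ∘ₗ
        (map f g : MinTensor A B →ₗ[ℂ] MinTensor A' B')) (g := 0)
      ((continuous_hom (map f g)).mul continuous_const) continuous_const (fun x y => h1 x y) z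

/-- The associativity graph is natural. -/
lemma assocGraph_map (f : A →⋆ₙₐ[ℂ] A') (g : B →⋆ₙₐ[ℂ] B') (h : C →⋆ₙₐ[ℂ] C')
    {y : MinTensor (MinTensor A B) C} {z : MinTensor A (MinTensor B C)}
    (hyz : (y, z) ∈ assocGraph A B C) :
    (map (map f g) h y, map f (map g h) z) ∈ assocGraph A' B' C' := by
  let F : MinTensor (MinTensor A B) C × MinTensor A (MinTensor B C) →ₗ[ℂ]
      MinTensor (MinTensor A' B') C' × MinTensor A' (MinTensor B' C') :=
    LinearMap.prodMap (map (map f g) h : _ →ₗ[ℂ] _) (map f (map g h) : _ →ₗ[ℂ] _)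
  have hF : Continuous F :=
    (continuous_hom (map (map f g) h)).prodMap (continuous_hom (map f (map g h)))
  have : assocGraph A B C ≤ (assocGraph A' B' C').comap F := by
    refine Submodule.topologicalClosure_minimal _ ?_
      ((Submodule.isClosed_topologicalClosure _).preimage hF)
    rw [Submodule.span_le]
    rintro _ ⟨⟨a, b, c⟩, rfl⟩
    refine Submodule.le_topologicalClosure _ (Submodule.subset_span ⟨(f a, g b, h c), ?_⟩)
    change (_, _) = (map (map f g) h _, map f (map g h) _)
    simp
  exact this hyz

lemma map_sum_left {κ : Type*} (s : Finset κ) (F : A →⋆ₙₐ[ℂ] A') (f : κ → A →⋆ₙₐ[ℂ] A')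
    (hF : ∀ x, F x = ∑ i ∈ s, f i x) (g : B →⋆ₙₐ[ℂ] B') (z : MinTensor A B) :
    map F g z = ∑ i ∈ s, map (f i) g z := by
  have := eq_of_tmul (f := (map F g : _ →ₗ[ℂ] MinTensor A' B'))
    (g := ∑ i ∈ s, (map (f i) g : _ →ₗ[ℂ] MinTensor A' B')) (continuous_hom (map F g))
    (by rw [LinearMap.coe_sum, Finset.sum_fn]
        exact continuous_finsetSum s fun i _ => continuous_hom (map (f i) g)) (fun x y => by
      simp only [LinearMap.sum_apply]
      change map F g _ = ∑ i ∈ s, map (f i) g _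
      simp only [map_tmul, hF]
      exact congr($(map_sum (mkL A' B') (fun i => f i x) s) (g y)) |>.trans (by simp)) z
  simpa using this

lemma map_sum_right {κ : Type*} (s : Finset κ) (f : A →⋆ₙₐ[ℂ] A') (G : B →⋆ₙₐ[ℂ] B')
    (g : κ → B →⋆ₙₐ[ℂ] B') (hG : ∀ x, G x = ∑ i ∈ s, g i x) (z : MinTensor A B) :
    map f G z = ∑ i ∈ s, map f (g i) z := by
  have := eq_of_tmul (f := (map f G : _ →ₗ[ℂ] MinTensor A' B'))
    (g := ∑ i ∈ s, (map f (g i) : _ →ₗ[ℂ] MinTensor A' B')) (continuous_hom (map f G))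
    (by rw [LinearMap.coe_sum, Finset.sum_fn]
        exact continuous_finsetSum s fun i _ => continuous_hom (map f (g i))) (fun x y => by
      simp only [LinearMap.sum_apply]
      change map f G _ = ∑ i ∈ s, map f (g i) _
      simp only [map_tmul, hG]
      exact (map_sum (mkL A' B' (f x)) (fun i => g i y) s).trans (by simp)) z
  simpa using this

end MinTensor

namespace WCS

section block

variable {M : Type u} (A : M → Type u) [∀ a, CStarAlgebra (A a)]

/-- The inclusion `A_b ⊗ A_c → A_* ⊗ A_*`. -/
def block (b c : M) : MinTensor (A b) (A c) →⋆ₙₐ[ℂ] MinTensor (C0Sum A) (C0Sum A) :=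
  MinTensor.map (C0Sum.incl A b) (C0Sum.incl A c)

lemma block_mul_block (b c b' c' : M) (h : (b, c) ≠ (b', c')) (y : MinTensor (A b) (A c))
    (z : MinTensor (A b') (A c')) : block A b c y * block A b' c' z = 0 := by
  refine MinTensor.map_mul_map_eq_zero_left _ _ _ _ (fun x y x' y' => ?_) y z
  by_cases hb : b = b'
  · have hc : c ≠ c' := by rintro rfl; exact h (by rw [hb])
    exact .inr (C0Sum.incl_mul_incl_ne A hc _ _)
  · exact .inl (C0Sum.incl_mul_incl_ne A hb _ _)

lemma block_tmul (b c : M) (x : A b) (y : A c) :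
    block A b c (MinTensor.tmul x y) = MinTensor.tmul (C0Sum.incl A b x) (C0Sum.incl A c y) :=
  MinTensor.map_tmul _ _ _ _

/-- A closed subspace containing all `ι_b(y) ⊗ ι_c(z)` is everything. -/
lemma mem_of_incl_tmul_incl {R : Submodule ℂ (MinTensor (C0Sum A) (C0Sum A))}
    (hR : IsClosed (R : Set (MinTensor (C0Sum A) (C0Sum A))))
    (h : ∀ (b c : M) (y : A b) (z : A c),
      MinTensor.tmul (C0Sum.incl A b y) (C0Sum.incl A c z) ∈ R)
    (w : MinTensor (C0Sum A) (C0Sum A)) : w ∈ R := by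
  refine MinTensor.mem_of_tmul_mem R hR (fun x y => ?_) w
  have h1 : ∀ b (x : A b) (y : C0Sum A), MinTensor.tmul (C0Sum.incl A b x) y ∈ R := fun b x y =>
    hR.mem_of_tendsto ((C0Sum.hasSum_incl A y).mapL (MinTensor.mkL (C0Sum A) (C0Sum A) (C0Sum.incl A b x)))
      (.of_forall fun s => R.sum_mem fun c _ => h b c x _)
  exact hR.mem_of_tendsto ((C0Sum.hasSum_incl A x).mapL ((MinTensor.mkL (C0Sum A) (C0Sum A)).flip y))
      (.of_forall fun s => R.sum_mem fun b _ => h1 b _ y)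

end block

variable {M : Type u} [Monoid M] {A : M → Type u} [∀ a, CStarAlgebra (A a)] (S : WCS A)

lemma comulTerm_mul (a a' : M) (p : Factorizations a) (q : Factorizations a')
    (h : p.1 ≠ q.1) (x : A a) (y : A a') :
    block A p.1.1 p.1.2 (S.φ p.2 x) * block A q.1.1 q.1.2 (S.φ q.2 y) = 0 :=
  block_mul_block A _ _ _ _ h _ _

variable [FiniteFactorization M]

/-- `Δ^{(a)}(x) = ∑_{(b,c) ∈ N_a} φ_{b,c}(x)`, as a map from `A_a` to `A_* ⊗ A_*`. -/
def comulAt (a : M) : A a →⋆ₙₐ[ℂ] MinTensor (C0Sum A) (C0Sum A) :=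
  sumHom (Finset.univ : Finset (Factorizations a))
    (fun p => (block A p.1.1 p.1.2).comp (S.φ p.2))
    (fun p q h => S.comulTerm_mul a a p q (fun h' => h (Subtype.ext h')))

lemma comulAt_apply (a : M) (x : A a) :
    S.comulAt a x = ∑ p : Factorizations a, block A p.1.1 p.1.2 (S.φ p.2 x) := rfl

lemma comulAt_mul_comulAt (a a' : M) (h : a ≠ a') (x : A a) (y : A a') :
    S.comulAt a x * S.comulAt a' y = 0 := by
  rw [comulAt_apply, comulAt_apply, Finset.sum_mul_sum]
  refine Finset.sum_eq_zero fun p _ => Finset.sum_eq_zero fun q _ => ?_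
  refine S.comulTerm_mul a a' p q (fun h' => h ?_) x y
  rw [← p.2, ← q.2, h']

/-- The finite partial sums of the comultiplication. -/
def comulPartial (s : Finset M) : C0Sum A →⋆ₙₐ[ℂ] MinTensor (C0Sum A) (C0Sum A) :=
  sumHom s (fun a => (S.comulAt a).comp (C0Sum.coord A a))
    (fun a a' h _ _ => S.comulAt_mul_comulAt a a' h _ _)

lemma comulPartial_apply (s : Finset M) (x : C0Sum A) :
    S.comulPartial s x = ∑ a ∈ s, S.comulAt a (C0Sum.coord A a x) := rfl

lemma summable_comul (x : C0Sum A) :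
    Summable fun a => S.comulAt a (C0Sum.coord A a x) := by
  have hx := (C0Sum.hasSum_incl A x).summable
  rw [summable_iff_vanishing_norm] at hx ⊢
  intro ε hε
  obtain ⟨s, hs⟩ := hx ε hε
  refine ⟨s, fun t ht => lt_of_le_of_lt ?_ (hs t ht)⟩
  have : ∑ a ∈ t, S.comulAt a (C0Sum.coord A a x) =
      S.comulPartial t (∑ a ∈ t, C0Sum.incl A a (C0Sum.coord A a x)) := by
    rw [comulPartial_apply]
    refine Finset.sum_congr rfl fun a ha => ?_
    rw [C0Sum.coord_sum_incl, if_pos ha]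
  rw [this]
  exact NonUnitalStarAlgHom.norm_apply_le _ _

/-- The comultiplication `Δ_φ = ⊕_a Δ^{(a)}`, i.e. `Δ_φ(x) = ∑_a Δ^{(a)}(x_a)`. -/
def comul : C0Sum A →⋆ₙₐ[ℂ] MinTensor (C0Sum A) (C0Sum A) where
  toFun x := ∑' a, S.comulAt a (C0Sum.coord A a x)
  map_smul' c x := by simp [(S.summable_comul x).tsum_const_smul c]
  map_zero' := by simp
  map_add' x y := by
    rw [← (S.summable_comul x).tsum_add (S.summable_comul y)]
    simp
  map_mul' x y := by
    refine tendsto_nhds_unique (S.summable_comul (x * y)).hasSum ?_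
    refine (Filter.Tendsto.mul (S.summable_comul x).hasSum (S.summable_comul y).hasSum).congr
      fun s => ?_
    exact (map_mul (S.comulPartial s) x y).symm
  map_star' x := by
    rw [tsum_star]
    simp [map_star]

lemma comul_apply (x : C0Sum A) : S.comul x = ∑' a, S.comulAt a (C0Sum.coord A a x) := rfl

@[simp] lemma comul_incl (a : M) (x : A a) : S.comul (C0Sum.incl A a x) = S.comulAt a x := by
  rw [comul_apply, tsum_eq_single a, C0Sum.coord_incl_self]
  intro b hb
  rw [C0Sum.coord_incl_ne A hb, map_zero]

lemma comul_dense : (Submodule.span ℂ (Set.range fun t : C0Sum A × C0Sum A × C0Sum A =>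
    S.comul t.1 * MinTensor.tmul t.2.1 t.2.2)).topologicalClosure = ⊤ := by
  refine eq_top_iff.2 fun w _ => mem_of_incl_tmul_incl A (Submodule.isClosed_topologicalClosure _)
    (fun b c y z => ?_) w
  refine Submodule.le_topologicalClosure _ (Submodule.subset_span
    ⟨(C0Sum.incl A (b * c) 1, C0Sum.incl A b y, C0Sum.incl A c z), ?_⟩)
  change S.comul (C0Sum.incl A (b * c) 1) * _ = _
  rw [comul_incl, comulAt_apply, ← block_tmul A, Finset.sum_mul,
    Finset.sum_eq_single_of_mem ⟨(b, c), rfl⟩ (Finset.mem_univ _)]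
  · rw [← map_mul, S.φ_one, MinTensor.tmul_mul_tmul, one_mul, one_mul]
  · intro p _ hp
    exact block_mul_block A _ _ _ _ (fun h => hp (Subtype.ext h)) _ _

/-- Factorizations `a = (b c) d = b (c d)`. -/
def factorizationsAssoc (a : M) :
    (Σ p : Factorizations a, Factorizations p.1.1) ≃
      (Σ p : Factorizations a, Factorizations p.1.2) where
  toFun t := ⟨⟨(t.2.1.1, t.2.1.2 * t.1.1.2), by
    rw [← mul_assoc, t.2.2, t.1.2]⟩, ⟨(t.2.1.2, t.1.1.2), rfl⟩⟩
  invFun t := ⟨⟨(t.1.1.1 * t.2.1.1, t.2.1.2), by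
    rw [mul_assoc, t.2.2, t.1.2]⟩, ⟨(t.1.1.1, t.2.1.1), rfl⟩⟩
  left_inv := by
    rintro ⟨⟨⟨p, d⟩, h⟩, ⟨⟨b, c⟩, h'⟩⟩
    dsimp at h'
    subst h'
    rfl
  right_inv := by
    rintro ⟨⟨⟨b, p⟩, h⟩, ⟨⟨c, d⟩, h'⟩⟩
    dsimp at h'
    subst h'
    rfl

lemma comul_left_term (a : M) (x : A a) :
    MinTensor.map S.comul (NonUnitalStarAlgHom.id ℂ (C0Sum A)) (S.comulAt a x) =
      ∑ t : (Σ p : Factorizations a, Factorizations p.1.1),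
        MinTensor.map (block A t.2.1.1 t.2.1.2) (C0Sum.incl A t.1.1.2)
          (MinTensor.map (S.φ t.2.2) (NonUnitalStarAlgHom.id ℂ (A t.1.1.2)) (S.φ t.1.2 x)) := by
  rw [comulAt_apply, map_sum, Fintype.sum_sigma]
  refine Finset.sum_congr rfl fun p _ => ?_
  rw [block, MinTensor.map_map]
  rw [MinTensor.map_sum_left Finset.univ _
    (fun q : Factorizations p.1.1 => (block A q.1.1 q.1.2).comp (S.φ q.2)) (fun y => by
      change S.comul (C0Sum.incl A _ y) = _
      rw [comul_incl]; rfl)]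
  refine Finset.sum_congr rfl fun q _ => ?_
  rw [MinTensor.map_map]
  rfl

lemma comul_right_term (a : M) (x : A a) :
    MinTensor.map (NonUnitalStarAlgHom.id ℂ (C0Sum A)) S.comul (S.comulAt a x) =
      ∑ t : (Σ p : Factorizations a, Factorizations p.1.2),
        MinTensor.map (C0Sum.incl A t.1.1.1) (block A t.2.1.1 t.2.1.2)
          (MinTensor.map (NonUnitalStarAlgHom.id ℂ (A t.1.1.1)) (S.φ t.2.2) (S.φ t.1.2 x)) := by
  rw [comulAt_apply, map_sum, Fintype.sum_sigma]
  refine Finset.sum_congr rfl fun p _ => ?_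
  rw [block, MinTensor.map_map]
  rw [MinTensor.map_sum_right Finset.univ _ _
    (fun q : Factorizations p.1.2 => (block A q.1.1 q.1.2).comp (S.φ q.2)) (fun y => by
      change S.comul (C0Sum.incl A _ y) = _
      rw [comul_incl]; rfl)]
  refine Finset.sum_congr rfl fun q _ => ?_
  rw [MinTensor.map_map]
  rfl

lemma comul_coassoc_incl (a : M) (x : A a) :
    (MinTensor.map S.comul (NonUnitalStarAlgHom.id ℂ (C0Sum A)) (S.comulAt a x),
      MinTensor.map (NonUnitalStarAlgHom.id ℂ (C0Sum A)) S.comul (S.comulAt a x)) ∈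
      assocGraph (C0Sum A) (C0Sum A) (C0Sum A) := by
  rw [comul_left_term, comul_right_term, ← (factorizationsAssoc a).sum_comp, prod_mk_sum]
  refine Submodule.sum_mem _ ?_
  rintro ⟨⟨⟨p, d⟩, h⟩, ⟨⟨b, c⟩, h'⟩⟩ -
  exact MinTensor.assocGraph_map (C0Sum.incl A b) (C0Sum.incl A c) (C0Sum.incl A d)
    (S.coassoc (a := b) (b := c) (c := d) (ab := p) (bc := c * d) (abc := a) h' rfl h
      (by rw [← mul_assoc, ← h, ← h']) x)

lemma comul_coassoc (x : C0Sum A) :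
    (MinTensor.map S.comul (NonUnitalStarAlgHom.id ℂ (C0Sum A)) (S.comul x),
      MinTensor.map (NonUnitalStarAlgHom.id ℂ (C0Sum A)) S.comul (S.comul x)) ∈
      assocGraph (C0Sum A) (C0Sum A) (C0Sum A) := by
  have h := (S.summable_comul x).hasSum
  have h1 := (((MinTensor.continuous_hom (MinTensor.map S.comul
    (NonUnitalStarAlgHom.id ℂ (C0Sum A)))).prodMk (MinTensor.continuous_hom (MinTensor.map
    (NonUnitalStarAlgHom.id ℂ (C0Sum A)) S.comul))).tendsto _).comp h
  refine (Submodule.isClosed_topologicalClosure _).mem_of_tendsto h1 (.of_forall fun s => ?_)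
  simp only [Function.comp_apply, map_sum]
  rw [prod_mk_sum]
  exact Submodule.sum_mem _ fun a _ => S.comul_coassoc_incl a _

/-- The C⋆-bialgebra `(A_*, Δ_φ)` associated with a C⋆-weakly coassociative system. -/
def bialgebra : StrictlyProperBialgebra (C0Sum A) where
  comul := S.comul
  dense_span := S.comul_dense
  coassoc := S.comul_coassoc

end WCS


/-! ### Covariant representations of C⋆-bialgebras -/

section BialgebraRep

/-- `W` is a partial isometry: `W W⋆ W = W`. -/
def IsPartialIsometry {H K : Type*} [NormedAddCommGroup H] [InnerProductSpace ℂ H]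
    [CompleteSpace H] [NormedAddCommGroup K] [InnerProductSpace ℂ K] [CompleteSpace K]
    (W : H →L[ℂ] K) : Prop :=
  W ∘L W.adjoint ∘L W = W

lemma IsPartialIsometry.norm_le_one {H K : Type*} [NormedAddCommGroup H] [InnerProductSpace ℂ H]
    [CompleteSpace H] [NormedAddCommGroup K] [InnerProductSpace ℂ K] [CompleteSpace K]
    {W : H →L[ℂ] K} (hW : IsPartialIsometry W) : ‖W‖ ≤ 1 := by
  set P := W.adjoint ∘L W with hP
  have h1 : P.adjoint = P := by
    rw [hP, ContinuousLinearMap.adjoint_comp, ContinuousLinearMap.adjoint_adjoint]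
  have h2 : P ∘L P = P := by
    rw [hP, ContinuousLinearMap.comp_assoc]
    exact congrArg (W.adjoint ∘L ·) hW
  have h3 := ContinuousLinearMap.norm_adjoint_comp_self P
  rw [h1, h2] at h3
  have h4 : ‖P‖ = ‖W‖ * ‖W‖ := ContinuousLinearMap.norm_adjoint_comp_self W
  have h5 : ‖P‖ ≤ 1 := by
    by_contra! h
    nlinarith
  nlinarith [norm_nonneg W]

variable {A : Type u} [NonUnitalCStarAlgebra A] {H : Type u} [NormedAddCommGroup H]
  [InnerProductSpace ℂ H] [CompleteSpace H]

/-- `(H, π, W)` is a quasi-covariant representation of the C⋆-bialgebra `(A, Δ)`: `π` is a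
`*`-representation of `A` on `H` and `W` is a nonzero partial isometry on `H ⊗ H` such that
`W (π(a) ⊗ I) = (π ⊗ π)(Δ(a)) W` for all `a`. -/
structure IsQuasiCovariantRep (B : StrictlyProperBialgebra A) (π : A →⋆ₙₐ[ℂ] (H →L[ℂ] H))
    (W : HTensor H H →L[ℂ] HTensor H H) : Prop where
  ne_zero : W ≠ 0
  isPartialIsometry : IsPartialIsometry W
  covariance : ∀ a : A, W ∘L HTensor.map (π a) (ContinuousLinearMap.id ℂ H) =
    MinTensor.prodRep π π (B.comul a) ∘L W

/-- A covariant representation is a quasi-covariant one for which `W⋆` is an isometry. -/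
structure IsCovariantRep (B : StrictlyProperBialgebra A) (π : A →⋆ₙₐ[ℂ] (H →L[ℂ] H))
    (W : HTensor H H →L[ℂ] HTensor H H) : Prop extends IsQuasiCovariantRep B π W where
  isometry_adjoint : Isometry W.adjoint

/-- A quasi-covariant representation is pentagonal if `W₁₂ W₁₃ W₂₃ = W₂₃ W₁₂`. -/
structure IsPentagonalRep (B : StrictlyProperBialgebra A) (π : A →⋆ₙₐ[ℂ] (H →L[ℂ] H))
    (W : HTensor H H →L[ℂ] HTensor H H) : Prop extends IsQuasiCovariantRep B π W where
  pentagon : HTensor.leg12 H W ∘L HTensor.leg13 H W ∘L HTensor.leg23 H W =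
    HTensor.leg23 H W ∘L HTensor.leg12 H W

end BialgebraRep

/-! ### Covariant representations of C⋆-weakly coassociative systems -/

/-- A quasi-covariant representation of a C⋆-weakly coassociative system on the Hilbert spaces
`H_a`. The operator `W^{(a,b)} : H_{ab} ⊗ H_b → H_a ⊗ H_b` is given as
`W h : H_c ⊗ H_b → H_a ⊗ H_b` for the proof `h` of `a b = c`. -/
structure QuasiCovariantRep {M : Type u} [Monoid M] {A : M → Type u} [∀ a, CStarAlgebra (A a)]
    (S : WCS A) (H : M → Type u) [∀ a, NormedAddCommGroup (H a)]
    [∀ a, InnerProductSpace ℂ (H a)] [∀ a, CompleteSpace (H a)] where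
  π : ∀ a, A a →⋆ₐ[ℂ] (H a →L[ℂ] H a)
  W : ∀ {a b c : M}, a * b = c → (HTensor (H c) (H b) →L[ℂ] HTensor (H a) (H b))
  W_ne_zero : ∀ {a b c : M} (h : a * b = c), W h ≠ 0
  isPartialIsometry : ∀ {a b c : M} (h : a * b = c), IsPartialIsometry (W h)
  covariance : ∀ {a b c : M} (h : a * b = c) (x : A c),
    W h ∘L HTensor.map (π c x) (ContinuousLinearMap.id ℂ (H b)) =
      MinTensor.prodRep (π a).toNonUnitalStarAlgHom (π b).toNonUnitalStarAlgHom (S.φ h x) ∘L W h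

namespace QuasiCovariantRep

variable {M : Type u} [Monoid M] {A : M → Type u} [∀ a, CStarAlgebra (A a)]
  {S : WCS A} {H : M → Type u} [∀ a, NormedAddCommGroup (H a)]
  [∀ a, InnerProductSpace ℂ (H a)] [∀ a, CompleteSpace (H a)] (R : QuasiCovariantRep S H)

/-- The representation is covariant if every `(W^{(a,b)})⋆` is an isometry. -/
def IsCovariant : Prop := ∀ {a b c : M} (h : a * b = c), Isometry (R.W h).adjoint

/-- The representation is pentagonal if
`W^{(a,b)}₁₂ W^{(ab,c)}₁₃ W^{(b,c)}₂₃ = W^{(b,c)}₂₃ W^{(a,bc)}₁₂` on `H_{abc} ⊗ H_{bc} ⊗ H_c`. -/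
def IsPentagonal : Prop :=
  ∀ {a b c ab bc abc : M} (hab : a * b = ab) (hbc : b * c = bc) (h : ab * c = abc)
    (h' : a * bc = abc),
    HTensor.leg12 (H c) (R.W hab) ∘L HTensor.leg13 (H b) (R.W h) ∘L
      HTensor.leg23 (H abc) (R.W hbc) =
    HTensor.leg23 (H a) (R.W hbc) ∘L HTensor.leg12 (H c) (R.W h')

/-- The direct sum representation `π = ⊕ π_a` of `A_* = ⊕ A_a` on `⊕ H_a`:
`(π(x) ξ)_a = π_a(x_a) ξ_a`. -/
def sumπ : C0Sum A →⋆ₙₐ[ℂ] (lp H 2 →L[ℂ] lp H 2) where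
  toFun x := diag (fun a => R.π a (C0Sum.coord A a x)) ‖x‖ (fun a =>
    (NonUnitalStarAlgHom.norm_apply_le (R.π a) _).trans
      (NonUnitalStarAlgHom.norm_apply_le (C0Sum.coord A a) x))
  map_smul' c x := by
    ext ξ a
    simp
  map_zero' := by
    ext ξ a
    simp
  map_add' x y := by
    ext ξ a
    simp
  map_mul' x y := by
    ext ξ a
    simp
  map_star' x := by
    refine (ContinuousLinearMap.eq_adjoint_iff _ _).2 fun ξ η => ?_
    rw [lp.inner_eq_tsum, lp.inner_eq_tsum]
    refine tsum_congr fun a => ?_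
    rw [diag_apply, diag_apply, map_star, map_star, ContinuousLinearMap.star_eq_adjoint,
      ContinuousLinearMap.adjoint_inner_left]

end QuasiCovariantRep

section Summand

variable {M : Type u} {H : M → Type u} [∀ a, NormedAddCommGroup (H a)]
  [∀ a, InnerProductSpace ℂ (H a)]

lemma inner_summand_ne {a b : M} (h : a ≠ b) (x : H a) (y : H b) :
    inner ℂ (summand a x) (summand b y) = (0 : ℂ) := by
  classical
  refine (lp.inner_single_left a x (summand b y)).trans ?_
  change inner ℂ x (lp.single 2 b y a) = _
  rw [lp.single_apply_ne _ _ _ h, inner_zero_right]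

lemma hasSum_summand (x : lp H 2) : HasSum (fun a => summand a (x a)) x := by
  classical
  exact lp.hasSum_single (by norm_num) x

end Summand

section Decomposition

variable {M : Type u} (H : M → Type u) [∀ a, NormedAddCommGroup (H a)]
  [∀ a, InnerProductSpace ℂ (H a)]

/-- The subspace `H_a ⊗ H_b` of `H ⊗ H`, where `H = ⊕ H_a`. -/
def corner (p : M × M) : HTensor (H p.1) (H p.2) →ₗᵢ[ℂ] HTensor (lp H 2) (lp H 2) :=
  HTensor.mapIsometry (summand p.1) (summand p.2)

lemma isHilbertSum_corner :
    IsHilbertSum ℂ (fun p : M × M => HTensor (H p.1) (H p.2)) (corner H) := by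
  refine IsHilbertSum.mk ?_ ?_
  · intro p q hpq v w
    have key : (corner H q).toContinuousLinearMap.adjoint ∘L
        (corner H p).toContinuousLinearMap = 0 := by
      refine HTensor.ext_tmul fun x y => HTensor.ext_inner fun x' y' => ?_
      rw [ContinuousLinearMap.comp_apply, ContinuousLinearMap.adjoint_inner_left,
        zero_apply, inner_zero_left]
      change inner ℂ (HTensor.mapIsometry _ _ (HTensor.tmul x y))
        (HTensor.mapIsometry _ _ (HTensor.tmul x' y')) = 0
      rw [HTensor.mapIsometry_tmul, HTensor.mapIsometry_tmul, HTensor.inner_tmul]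
      by_cases h : p.1 = q.1
      · have h2 : p.2 ≠ q.2 := fun h2 => hpq (Prod.ext h h2)
        rw [inner_summand_ne h2, mul_zero]
      · rw [inner_summand_ne h, zero_mul]
    have := congr(inner ℂ ($key v) w)
    rw [ContinuousLinearMap.comp_apply, ContinuousLinearMap.adjoint_inner_left,
      zero_apply, inner_zero_left] at this
    exact this
  · intro z _
    set R := (⨆ p, (corner H p).toLinearMap.range).topologicalClosure
    have hR : IsClosed (R : Set (HTensor (lp H 2) (lp H 2))) :=
      Submodule.isClosed_topologicalClosure _
    have h0 : ∀ a b (x : H a) (y : H b), HTensor.tmul (summand a x) (summand b y) ∈ R :=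
      fun a b x y => Submodule.le_topologicalClosure _ (Submodule.mem_iSup_of_mem (a, b)
        ⟨HTensor.tmul x y, HTensor.mapIsometry_tmul _ _ x y⟩)
    have h1 : ∀ a (x : H a) (y : lp H 2), HTensor.tmul (summand a x) y ∈ R := fun a x y =>
      hR.mem_of_tendsto ((hasSum_summand y).mapL (HTensor.mkL (lp H 2) (lp H 2) (summand a x)))
        (.of_forall fun s => R.sum_mem fun b _ => h0 a b x _)
    exact HTensor.mem_of_tmul_mem R hR (fun x y =>
      hR.mem_of_tendsto ((hasSum_summand x).mapL ((HTensor.mkL (lp H 2) (lp H 2)).flip y))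
        (.of_forall fun s => R.sum_mem fun a _ => h1 a _ y)) z

/-- The canonical unitary `H ⊗ H ≅ ⊕_{a,b} H_a ⊗ H_b`, where `H = ⊕ H_a`. -/
def decomp : HTensor (lp H 2) (lp H 2) ≃ₗᵢ[ℂ] lp (fun p : M × M => HTensor (H p.1) (H p.2)) 2 :=
  (isHilbertSum_corner H).linearIsometryEquiv

end Decomposition

/-- In a right cancellative monoid, `(a, b) ↦ (a b, b)` is injective. -/
lemma injective_mulRight (M : Type*) [Mul M] [IsRightCancelMul M] :
    Function.Injective fun p : M × M => (p.1 * p.2, p.2) := by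
  rintro ⟨a, b⟩ ⟨a', b'⟩ h
  simp only [Prod.mk.injEq] at h
  obtain ⟨h1, rfl⟩ := h
  rw [mul_right_cancel h1]

namespace QuasiCovariantRep

variable {M : Type u} [Monoid M] [IsRightCancelMul M] {A : M → Type u} [∀ a, CStarAlgebra (A a)]
  {S : WCS A} {H : M → Type u} [∀ a, NormedAddCommGroup (H a)]
  [∀ a, InnerProductSpace ℂ (H a)] [∀ a, CompleteSpace (H a)] (R : QuasiCovariantRep S H)

/-- The direct sum `W = ⊕_{a,b} W^{(a,b)}` on `H ⊗ H = ⊕_{a,b} H_a ⊗ H_b`: it maps the summand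
`H_{ab} ⊗ H_b` to `H_a ⊗ H_b` by `W^{(a,b)}`, and it vanishes on the summands that are not of the
form `H_{ab} ⊗ H_b`. In coordinates, `(W ζ)_{(a,b)} = W^{(a,b)} ζ_{(ab,b)}`. -/
def sumW : HTensor (lp H 2) (lp H 2) →L[ℂ] HTensor (lp H 2) (lp H 2) :=
  (decomp H).symm.toContinuousLinearEquiv.toContinuousLinearMap ∘L
    diag (fun p : M × M => R.W (rfl : p.1 * p.2 = p.1 * p.2)) 1
      (fun _ => (R.isPartialIsometry _).norm_le_one) ∘L
    pick (G := fun p : M × M => HTensor (H p.1) (H p.2)) (fun p : M × M => (p.1 * p.2, p.2))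
      (injective_mulRight M) ∘L
    (decomp H).toContinuousLinearEquiv.toContinuousLinearMap

lemma decomp_sumW (ζ : HTensor (lp H 2) (lp H 2)) (p : M × M) :
    decomp H (R.sumW ζ) p = R.W rfl (decomp H ζ (p.1 * p.2, p.2)) :=
  congrArg (fun η : lp (fun p : M × M => HTensor (H p.1) (H p.2)) 2 => η p)
    ((decomp H).apply_symm_apply _)

end QuasiCovariantRep

end CWCS

end

/-! Write `P_{a,b} = p_a ⊗ p_b` for the projection of `H ⊗ H` onto `H_a ⊗ H_b` (`cornerProj`). An
operator into `H ⊗ H` is determined by its composites with all `P_{a,b}` (`ext_cornerProj`), so each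
identity for `W` can be checked one target summand at a time. The definition of `W` amounts to the
intertwining relation `P_{a,b} W = W^{(a,b)} P_{ab,b}` (`cornerProj_sumW`), which moves projections
from left to right through any product of operators built from `W`.

Adjoints need information about the source side as well. Since right cancellation makes `(a,b) ↦
(ab,b)` injective, `W` sends `H_{ab} ⊗ H_b` into the single summand `H_a ⊗ H_b` (`sumW_corner`).
Dualizing gives `P_{ab,b} W⋆ = (W^{(a,b)})⋆ P_{a,b}`. Hence `W W⋆` is block diagonal with blocks
`W^{(a,b)} (W^{(a,b)})⋆`, and both `W W⋆ W = W` and `W W⋆ = I` reduce to the blocks.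

For covariance, `P_{a,b}` intertwines `(π ⊗ π)(z)` with `π_a ⊗ π_b` applied to the component of `z`
in `A_a ⊗ A_b` (`cornerProj_prodRep_sumπ`). The component of `Δ_φ(x)` is `φ_{a,b}(x_{ab})`, because
the only term of the series that reaches `A_a ⊗ A_b` is the one for the factorization `(a,b)` of
`ab` (`map_coord_comul`).

For the pentagon, the intertwining relation passes to each leg (`map_leg12`, `map_leg13`,
`map_leg23`). Moving `p_a ⊗ p_b ⊗ p_c` through either side leaves the corresponding side of the
pentagon for the blocks, followed by `p_{abc} ⊗ p_{bc} ⊗ p_c`. -/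

noncomputable section

namespace CWCS

/-! ### Coordinate projections of a Hilbert direct sum -/

section Projection

variable {ι : Type*} {G : ι → Type*} [∀ i, NormedAddCommGroup (G i)]
  [∀ i, InnerProductSpace ℂ (G i)]

/-- The projection onto a direct summand. -/
def proj (i : ι) : lp G 2 →L[ℂ] G i :=
  LinearMap.mkContinuous
    { toFun := fun x => x i
      map_add' := fun _ _ => rfl
      map_smul' := fun _ _ => rfl }
    1 (fun x => by rw [one_mul]; exact lp.norm_apply_le_norm (by norm_num) x i)

lemma proj_summand_self (i : ι) (x : G i) : proj i (summand i x) = x := by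
  classical
  exact lp.single_apply_self (E := G) 2 i x

/-- This duality converts relations about restricting an operator to a summand into relations about
projecting onto it, and back. -/
lemma adjoint_proj [∀ i, CompleteSpace (G i)] (i : ι) :
    (proj (G := G) i).adjoint = (summand i).toContinuousLinearMap := by
  classical
  refine ContinuousLinearMap.ext fun x => ext_inner_right ℂ fun y => ?_
  rw [ContinuousLinearMap.adjoint_inner_left]
  exact (lp.inner_single_left i x y).symm

end Projection

/-! ### Operators determined by their values on vectors from the summands -/

section Ext

variable {M : Type u} {H : M → Type u} [∀ a, NormedAddCommGroup (H a)]
  [∀ a, InnerProductSpace ℂ (H a)]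

/-- Every vector is the norm-convergent sum of its components, and continuous linear maps may be
applied termwise; limits are unique. -/
lemma ext_summand {E : Type*} [NormedAddCommGroup E] [NormedSpace ℂ E] {f g : lp H 2 →L[ℂ] E}
    (h : ∀ a x, f (summand a x) = g (summand a x)) : f = g :=
  ContinuousLinearMap.ext fun x => by
    refine ((hasSum_summand x).mapL f).unique ?_
    simpa only [h] using (hasSum_summand x).mapL g

/-- With the left factor fixed, both sides are bounded operators of the right factor. The left space
`K` is arbitrary so that it can later be either `⊕ H_a` or its tensor square. -/
lemma HTensor.ext_tmul_summand_right {E K : Type*} [NormedAddCommGroup E] [NormedSpace ℂ E]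
    [NormedAddCommGroup K] [InnerProductSpace ℂ K] {f g : HTensor K (lp H 2) →L[ℂ] E}
    (h : ∀ x b y, f (tmul x (summand b y)) = g (tmul x (summand b y))) : f = g :=
  ext_tmul fun x y => congr($(ext_summand (f := f ∘L mkL K (lp H 2) x)
    (g := g ∘L mkL K (lp H 2) x) (h x)) y)

lemma HTensor.ext_summand_tmul_summand {E : Type*} [NormedAddCommGroup E] [NormedSpace ℂ E]
    {f g : HTensor (lp H 2) (lp H 2) →L[ℂ] E}
    (h : ∀ a x b y, f (tmul (summand a x) (summand b y)) = g (tmul (summand a x) (summand b y))) :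
    f = g :=
  ext_tmul_summand_right fun x b y => congr($(ext_summand
    (f := f ∘L (mkL (lp H 2) (lp H 2)).flip (summand b y))
    (g := g ∘L (mkL (lp H 2) (lp H 2)).flip (summand b y)) fun a x => h a x b y) x)

lemma HTensor.ext_summand_tmul_summand_tmul_summand {E : Type*} [NormedAddCommGroup E]
    [NormedSpace ℂ E] {f g : HTensor (HTensor (lp H 2) (lp H 2)) (lp H 2) →L[ℂ] E}
    (h : ∀ a x b y c z, f (tmul (tmul (summand a x) (summand b y)) (summand c z)) =
      g (tmul (tmul (summand a x) (summand b y)) (summand c z))) :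
    f = g :=
  ext_tmul_summand_right fun w c z => congr($(ext_summand_tmul_summand
    (f := f ∘L (mkL _ (lp H 2)).flip (summand c z))
    (g := g ∘L (mkL _ (lp H 2)).flip (summand c z)) fun a x b y => h a x b y c z) w)

end Ext

/-! ### Naturality of the associator, the flip and the leg numbering -/

namespace HTensor

variable {H K L H' K' L' : Type*}
  [NormedAddCommGroup H] [InnerProductSpace ℂ H] [NormedAddCommGroup K] [InnerProductSpace ℂ K]
  [NormedAddCommGroup L] [InnerProductSpace ℂ L]
  [NormedAddCommGroup H'] [InnerProductSpace ℂ H'] [NormedAddCommGroup K'] [InnerProductSpace ℂ K']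
  [NormedAddCommGroup L'] [InnerProductSpace ℂ L']

lemma ext_tmul_tmul {E : Type*} [NormedAddCommGroup E] [NormedSpace ℂ E]
    {f g : HTensor (HTensor H K) L →L[ℂ] E}
    (h : ∀ x y z, f (tmul (tmul x y) z) = g (tmul (tmul x y) z)) : f = g :=
  ext_tmul fun w z => congr($(ext_tmul (f := f ∘L (mkL (HTensor H K) L).flip z)
    (g := g ∘L (mkL (HTensor H K) L).flip z) fun x y => h x y z) w)

lemma ext_tmul_tmul' {E : Type*} [NormedAddCommGroup E] [NormedSpace ℂ E]
    {f g : HTensor H (HTensor K L) →L[ℂ] E}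
    (h : ∀ x y z, f (tmul x (tmul y z)) = g (tmul x (tmul y z))) : f = g :=
  ext_tmul fun x w => congr($(ext_tmul (f := f ∘L mkL H (HTensor K L) x)
    (g := g ∘L mkL H (HTensor K L) x) fun y z => h x y z) w)

lemma assoc_map (f : H →L[ℂ] H') (g : K →L[ℂ] K') (k : L →L[ℂ] L') :
    (assoc H' K' L').toContinuousLinearEquiv.toContinuousLinearMap ∘L map (map f g) k =
      map f (map g k) ∘L (assoc H K L).toContinuousLinearEquiv.toContinuousLinearMap :=
  ext_tmul_tmul fun x y z => by simp

lemma assoc_symm_map (f : H →L[ℂ] H') (g : K →L[ℂ] K') (k : L →L[ℂ] L') :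
    (assoc H' K' L').symm.toContinuousLinearEquiv.toContinuousLinearMap ∘L map f (map g k) =
      map (map f g) k ∘L (assoc H K L).symm.toContinuousLinearEquiv.toContinuousLinearMap :=
  ext_tmul_tmul' fun x y z => by simp

lemma flip23_map (f : H →L[ℂ] H') (g : K →L[ℂ] K') (k : L →L[ℂ] L') :
    flip23 H' K' L' ∘L map (map f g) k = map (map f k) g ∘L flip23 H K L :=
  ext_tmul_tmul fun x y z => by simp [flip23_tmul]

variable {H₁ K₁ L₁ H₁' K₁' L₁' : Type*}
  [NormedAddCommGroup H₁] [InnerProductSpace ℂ H₁]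
  [NormedAddCommGroup K₁] [InnerProductSpace ℂ K₁]
  [NormedAddCommGroup L₁] [InnerProductSpace ℂ L₁]
  [NormedAddCommGroup H₁'] [InnerProductSpace ℂ H₁']
  [NormedAddCommGroup K₁'] [InnerProductSpace ℂ K₁']
  [NormedAddCommGroup L₁'] [InnerProductSpace ℂ L₁']

/-- In the application `T` is the summed `W`, `T₁` is a block `W^{(a,b)}`, and the remaining maps
are coordinate projections. The map `k` lives on the leg that `T` leaves alone, so it is free and
appears unchanged on both sides. -/
lemma map_leg12 {T : HTensor H K →L[ℂ] HTensor H' K'} {T₁ : HTensor H₁ K₁ →L[ℂ] HTensor H₁' K₁'}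
    {f : H →L[ℂ] H₁} {g : K →L[ℂ] K₁} {f' : H' →L[ℂ] H₁'} {g' : K' →L[ℂ] K₁'}
    (k : L →L[ℂ] L₁) (h : map f' g' ∘L T = T₁ ∘L map f g) :
    map (map f' g') k ∘L leg12 L T = leg12 L₁ T₁ ∘L map (map f g) k := by
  rw [leg12, leg12, map_comp, map_comp, h, ContinuousLinearMap.comp_id,
    ContinuousLinearMap.id_comp]

lemma map_leg23 {T : HTensor K L →L[ℂ] HTensor K' L'} {T₁ : HTensor K₁ L₁ →L[ℂ] HTensor K₁' L₁'}
    (f : H →L[ℂ] H₁) {g : K →L[ℂ] K₁} {k : L →L[ℂ] L₁} {g' : K' →L[ℂ] K₁'} {k' : L' →L[ℂ] L₁'}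
    (h : map g' k' ∘L T = T₁ ∘L map g k) :
    map (map f g') k' ∘L leg23 H T = leg23 H₁ T₁ ∘L map (map f g) k := by
  -- `I ⊗ T` is conjugated by the associator: the projections pass the inverse associator by
  -- naturality, then `I ⊗ T` by `h`, then the associator by naturality.
  rw [leg23, leg23, ← ContinuousLinearMap.comp_assoc, ← assoc_symm_map,
    ContinuousLinearMap.comp_assoc, ← ContinuousLinearMap.comp_assoc (map f (map g' k')),
    map_comp, h, ContinuousLinearMap.comp_assoc, ContinuousLinearMap.comp_assoc, assoc_map,
    ← ContinuousLinearMap.comp_assoc (map _ T₁), map_comp, ContinuousLinearMap.comp_id,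
    ContinuousLinearMap.id_comp]

lemma map_leg13 {T : HTensor H L →L[ℂ] HTensor H' L'} {T₁ : HTensor H₁ L₁ →L[ℂ] HTensor H₁' L₁'}
    {f : H →L[ℂ] H₁} (g : K →L[ℂ] K₁) {k : L →L[ℂ] L₁} {f' : H' →L[ℂ] H₁'} {k' : L' →L[ℂ] L₁'}
    (h : map f' k' ∘L T = T₁ ∘L map f k) :
    map (map f' g) k' ∘L leg13 K T = leg13 K₁ T₁ ∘L map (map f g) k := by
  -- The same movement, with the flip of the last two legs on each side of `T ⊗ I`; between the
  -- flips `g` acts on the third leg.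
  rw [leg13, leg13, ← ContinuousLinearMap.comp_assoc, ← flip23_map,
    ContinuousLinearMap.comp_assoc, ← ContinuousLinearMap.comp_assoc (map (map f' k') g),
    map_leg12 g h, ContinuousLinearMap.comp_assoc, ContinuousLinearMap.comp_assoc,
    ContinuousLinearMap.comp_assoc, flip23_map]

end HTensor

/-! ### Coordinates of `H ⊗ H` and of `H ⊗ H ⊗ H` -/

section Coordinates

variable {M : Type u} (H : M → Type u) [∀ a, NormedAddCommGroup (H a)]
  [∀ a, InnerProductSpace ℂ (H a)]

/-- The projection of `H ⊗ H` onto `H_a ⊗ H_b`, where `H = ⊕ H_a`. -/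
def cornerProj (a b : M) : HTensor (lp H 2) (lp H 2) →L[ℂ] HTensor (H a) (H b) :=
  HTensor.map (proj a) (proj b)

lemma cornerProj_corner_self (a b : M) (z : HTensor (H a) (H b)) :
    cornerProj H a b (corner H (a, b) z) = z := by
  refine congr($(HTensor.ext_tmul (f := cornerProj H a b ∘L (corner H (a, b)).toContinuousLinearMap)
    (g := ContinuousLinearMap.id ℂ _) fun x y => ?_) z)
  change cornerProj H a b (HTensor.mapIsometry _ _ (HTensor.tmul x y)) = _
  simp only [HTensor.mapIsometry_tmul, cornerProj, HTensor.map_tmul, proj_summand_self]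
  rfl

variable [∀ a, CompleteSpace (H a)]

lemma adjoint_cornerProj (a b : M) :
    (cornerProj H a b).adjoint = (corner H (a, b)).toContinuousLinearMap := by
  rw [cornerProj, HTensor.adjoint_map, adjoint_proj, adjoint_proj]
  rfl

/-- The inverse of `decomp` sends the family with the single entry `v` at `(a,b)` to `corner H (a,
b) v`. By unitarity, pairing `v` with the coordinate of `ζ` is pairing `corner H (a, b) v` with `ζ`,
and `corner` is the adjoint of `cornerProj`. The gain is that the coordinate becomes an operator of
the form `p_a ⊗ p_b`, compatible with `π ⊗ π` and with the legs. -/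
lemma decomp_apply (ζ : HTensor (lp H 2) (lp H 2)) (a b : M) :
    decomp H ζ (a, b) = cornerProj H a b ζ := by
  classical
  refine ext_inner_left ℂ fun v => ?_
  have h1 : (decomp H).symm
      (lp.single (E := fun p : M × M => HTensor (H p.1) (H p.2)) 2 (a, b) v) = corner H (a, b) v :=
    (isHilbertSum_corner H).linearIsometryEquiv_symm_apply_single v
  rw [← ContinuousLinearMap.adjoint_inner_left, adjoint_cornerProj]
  change _ = inner ℂ (corner H (a, b) v) ζ
  rw [← h1, ← LinearIsometryEquiv.inner_map_map (decomp H), LinearIsometryEquiv.apply_symm_apply]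
  exact (lp.inner_single_left (G := fun p : M × M => HTensor (H p.1) (H p.2)) (a, b) v
    (decomp H ζ)).symm

variable {H}

/-- Different corners are orthogonal subspaces. -/
lemma cornerProj_comp_corner_ne {a b c d : M} (h : (a, b) ≠ (c, d)) :
    cornerProj H a b ∘L (corner H (c, d)).toContinuousLinearMap = 0 := by
  refine ContinuousLinearMap.ext fun z => ext_inner_left ℂ fun w => ?_
  rw [ContinuousLinearMap.comp_apply, ← ContinuousLinearMap.adjoint_inner_left, adjoint_cornerProj,
    zero_apply, inner_zero_right]
  exact (isHilbertSum_corner H).OrthogonalFamily h w z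

/-- The `P_{a,b}` are the coordinates of the injective map `decomp`. -/
lemma ext_cornerProj {E : Type*} [NormedAddCommGroup E] [NormedSpace ℂ E]
    {T T' : E →L[ℂ] HTensor (lp H 2) (lp H 2)}
    (h : ∀ a b, cornerProj H a b ∘L T = cornerProj H a b ∘L T') : T = T' :=
  ContinuousLinearMap.ext fun z => (decomp H).injective <| lp.ext <| funext fun ⟨a, b⟩ => by
    rw [decomp_apply, decomp_apply]
    exact congr($(h a b) z)

/-- Adjoints turn a test on the target into a test on the source, where elementary tensors of
vectors from the summands span a dense subspace. This avoids a separate Hilbert sum decomposition of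
the threefold tensor product. -/
lemma ext_map_map_proj {E : Type*} [NormedAddCommGroup E] [InnerProductSpace ℂ E] [CompleteSpace E]
    {T T' : E →L[ℂ] HTensor (HTensor (lp H 2) (lp H 2)) (lp H 2)}
    (h : ∀ a b c, HTensor.map (cornerProj H a b) (proj c) ∘L T =
      HTensor.map (cornerProj H a b) (proj c) ∘L T') : T = T' := by
  apply ContinuousLinearMap.adjoint.injective
  refine HTensor.ext_summand_tmul_summand_tmul_summand fun a x b y c z => ?_
  have h1 := congr(ContinuousLinearMap.adjoint $(h a b c) (HTensor.tmul (HTensor.tmul x y) z))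
  rw [ContinuousLinearMap.adjoint_comp, ContinuousLinearMap.adjoint_comp, HTensor.adjoint_map,
    adjoint_cornerProj, adjoint_proj, ContinuousLinearMap.comp_apply,
    ContinuousLinearMap.comp_apply, HTensor.map_tmul] at h1
  have h2 : corner H (a, b) (HTensor.tmul x y) = HTensor.tmul (summand a x) (summand b y) :=
    HTensor.mapIsometry_tmul _ _ x y
  simpa [h2] using h1

end Coordinates

/-- An operator identity, unlike the metric condition, can be tested block by block. -/
lemma isometry_adjoint_iff {H K : Type*} [NormedAddCommGroup H] [InnerProductSpace ℂ H]
    [CompleteSpace H] [NormedAddCommGroup K] [InnerProductSpace ℂ K] [CompleteSpace K]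
    (W : H →L[ℂ] K) : Isometry W.adjoint ↔ W ∘L W.adjoint = ContinuousLinearMap.id ℂ K := by
  rw [ContinuousLinearMap.isometry_iff_adjoint_comp_self, ContinuousLinearMap.adjoint_adjoint]
  rfl

/-! ### Components of the comultiplication -/

namespace WCS

section block

variable {M : Type u} {A : M → Type u} [∀ a, CStarAlgebra (A a)]

lemma map_coord_block_self (a b : M) (z : MinTensor (A a) (A b)) :
    MinTensor.map (C0Sum.coord A a) (C0Sum.coord A b) (block A a b z) = z := by
  rw [block, MinTensor.map_map]
  exact MinTensor.hom_ext (g := NonUnitalStarAlgHom.id ℂ _) (fun x y => by simp) z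

lemma map_coord_block_ne {a b c d : M} (h : (a, b) ≠ (c, d)) (z : MinTensor (A c) (A d)) :
    MinTensor.map (C0Sum.coord A a) (C0Sum.coord A b) (block A c d z) = 0 := by
  rw [block, MinTensor.map_map]
  refine MinTensor.hom_ext (g := 0) (fun x y => ?_) z
  rw [MinTensor.map_tmul]
  simp only [NonUnitalStarAlgHom.comp_apply]
  by_cases ha : a = c
  · have hb : b ≠ d := fun hb => h (by rw [ha, hb])
    rw [C0Sum.coord_incl_ne A hb]
    exact map_zero (MinTensor.mkL (A a) (A b) _)
  · rw [C0Sum.coord_incl_ne A ha]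
    exact congr($(map_zero (MinTensor.mkL (A a) (A b))) _)

end block

variable {M : Type u} [Monoid M] [FiniteFactorization M] {A : M → Type u}
  [∀ a, CStarAlgebra (A a)] (S : WCS A)

/-- Distinct factorizations of `c` land in distinct blocks, so only the term of `(a, b)` survives.
-/
lemma map_coord_comulAt {a b c : M} (h : a * b = c) (x : A c) :
    MinTensor.map (C0Sum.coord A a) (C0Sum.coord A b) (S.comulAt c x) = S.φ h x := by
  rw [comulAt_apply, map_sum, Finset.sum_eq_single_of_mem ⟨(a, b), h⟩ (Finset.mem_univ _)]
  · exact map_coord_block_self a b _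
  · intro p _ hp
    exact map_coord_block_ne (fun h' => hp (Subtype.ext h'.symm)) _

lemma map_coord_comulAt_ne {a b c : M} (h : a * b ≠ c) (x : A c) :
    MinTensor.map (C0Sum.coord A a) (C0Sum.coord A b) (S.comulAt c x) = 0 := by
  rw [comulAt_apply, map_sum]
  exact Finset.sum_eq_zero fun p _ => map_coord_block_ne (fun h' => h (by
    simp only [Prod.mk.injEq] at h'
    rw [← p.2, h'.1, h'.2])) _

/-- The component of `Δ_φ(x)` in `A_a ⊗ A_b` is `φ_{a,b}(x_{ab})`. -/
lemma map_coord_comul {a b c : M} (h : a * b = c) (x : C0Sum A) :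
    MinTensor.map (C0Sum.coord A a) (C0Sum.coord A b) (S.comul x) = S.φ h (C0Sum.coord A c x) := by
  -- A `*`-homomorphism is continuous, so the component of the series is taken termwise; only the
  -- index `c = a b` contributes.
  have h1 := (S.summable_comul x).hasSum.map
    (MinTensor.map (C0Sum.coord A a) (C0Sum.coord A b)) (MinTensor.continuous_hom _)
  refine h1.unique ?_
  rw [← S.map_coord_comulAt h]
  refine hasSum_single c fun d hd => S.map_coord_comulAt_ne ?_ _
  rintro rfl
  exact hd h

end WCS

/-! ### Intertwining relations for `π ⊗ π`, `W` and `W⋆` -/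

namespace QuasiCovariantRep

variable {M : Type u} [Monoid M] {A : M → Type u} [∀ a, CStarAlgebra (A a)]
  {S : WCS A} {H : M → Type u} [∀ a, NormedAddCommGroup (H a)]
  [∀ a, InnerProductSpace ℂ (H a)] [∀ a, CompleteSpace (H a)] (R : QuasiCovariantRep S H)

lemma proj_sumπ (a : M) (x : C0Sum A) :
    proj a ∘L R.sumπ x = R.π a (C0Sum.coord A a x) ∘L proj a := rfl

/-- Both sides are linear and continuous in `z`, and on elementary tensors the claim splits into the
diagonal form of `π` on each factor. -/
lemma cornerProj_prodRep_sumπ (a b : M) (z : MinTensor (C0Sum A) (C0Sum A)) :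
    cornerProj H a b ∘L MinTensor.prodRep R.sumπ R.sumπ z =
      MinTensor.prodRep (R.π a).toNonUnitalStarAlgHom (R.π b).toNonUnitalStarAlgHom
        (MinTensor.map (C0Sum.coord A a) (C0Sum.coord A b) z) ∘L cornerProj H a b := by
  let ρ := (MinTensor.prodRep (R.π a).toNonUnitalStarAlgHom (R.π b).toNonUnitalStarAlgHom).comp
    (MinTensor.map (C0Sum.coord A a) (C0Sum.coord A b))
  -- `F` and `G` are composition with `P_{a,b}` on the left and on the right, as bounded linear maps
  -- on operators; they supply linearity and continuity of both sides.
  let F := ContinuousLinearMap.compL ℂ (HTensor (lp H 2) (lp H 2)) (HTensor (lp H 2) (lp H 2))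
    (HTensor (H a) (H b)) (cornerProj H a b)
  let G := (ContinuousLinearMap.compL ℂ (HTensor (lp H 2) (lp H 2)) (HTensor (H a) (H b))
    (HTensor (H a) (H b))).flip (cornerProj H a b)
  let f : MinTensor (C0Sum A) (C0Sum A) →ₗ[ℂ]
      (HTensor (lp H 2) (lp H 2) →L[ℂ] HTensor (lp H 2) (lp H 2)) :=
    MinTensor.prodRep R.sumπ R.sumπ
  let g : MinTensor (C0Sum A) (C0Sum A) →ₗ[ℂ]
      (HTensor (H a) (H b) →L[ℂ] HTensor (H a) (H b)) := ρ
  refine MinTensor.eq_of_tmul (f := F.toLinearMap ∘ₗ f) (g := G.toLinearMap ∘ₗ g)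
    (F.continuous.comp (MinTensor.continuous_hom (MinTensor.prodRep R.sumπ R.sumπ)))
    (G.continuous.comp (MinTensor.continuous_hom ρ)) (fun x y => ?_) z
  change cornerProj H a b ∘L MinTensor.prodRep R.sumπ R.sumπ (MinTensor.tmul x y) =
    MinTensor.prodRep (R.π a).toNonUnitalStarAlgHom (R.π b).toNonUnitalStarAlgHom
      (MinTensor.map (C0Sum.coord A a) (C0Sum.coord A b) (MinTensor.tmul x y)) ∘L cornerProj H a b
  rw [MinTensor.map_tmul, MinTensor.prodRep_tmul, MinTensor.prodRep_tmul, cornerProj,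
    HTensor.map_comp, HTensor.map_comp, proj_sumπ, proj_sumπ]
  rfl

variable [IsRightCancelMul M]

/-- This is the coordinate formula that defines `W`. The free index `c` lets the source be written
as `a * b * c` as well as `a * (b * c)` in the pentagon. -/
lemma cornerProj_sumW {a b c : M} (h : a * b = c) :
    cornerProj H a b ∘L R.sumW = R.W h ∘L cornerProj H c b := by
  subst h
  ext1 ζ
  rw [ContinuousLinearMap.comp_apply, ContinuousLinearMap.comp_apply, ← decomp_apply,
    ← decomp_apply]
  exact R.decomp_sumW ζ (a, b)

/-- `W` maps the summand `H_{ab} ⊗ H_b` to `H_a ⊗ H_b` by `W^{(a,b)}`. -/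
lemma sumW_corner {a b c : M} (h : a * b = c) :
    R.sumW ∘L (corner H (c, b)).toContinuousLinearMap =
      (corner H (a, b)).toContinuousLinearMap ∘L R.W h := by
  refine ext_cornerProj fun a' b' => ?_
  rw [← ContinuousLinearMap.comp_assoc, ← ContinuousLinearMap.comp_assoc, R.cornerProj_sumW rfl,
    ContinuousLinearMap.comp_assoc]
  by_cases h' : (a', b') = (a, b)
  · simp only [Prod.mk.injEq] at h'
    obtain ⟨rfl, rfl⟩ := h'
    subst h
    ext1 z
    simp [cornerProj_corner_self]
  -- Right cancellation enters here: `(a'b', b') = (ab, b)` would force `(a', b') = (a, b)`, so both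
  -- sides vanish in this component.
  · rw [cornerProj_comp_corner_ne h', cornerProj_comp_corner_ne, ContinuousLinearMap.comp_zero,
      ContinuousLinearMap.zero_comp]
    subst h
    exact fun h => h' (injective_mulRight M h)

/-- The adjoint of `sumW_corner`, with inclusions turned into projections. -/
lemma cornerProj_sumW_adjoint {a b c : M} (h : a * b = c) :
    cornerProj H c b ∘L R.sumW.adjoint = (R.W h).adjoint ∘L cornerProj H a b := by
  have h1 := congr(ContinuousLinearMap.adjoint $(R.sumW_corner h))
  rwa [ContinuousLinearMap.adjoint_comp, ContinuousLinearMap.adjoint_comp, ← adjoint_cornerProj,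
    ← adjoint_cornerProj, ContinuousLinearMap.adjoint_adjoint,
    ContinuousLinearMap.adjoint_adjoint] at h1

/-- `W⋆` undoes the change of index made by `W`, so `W W⋆` is block diagonal. Both the partial
isometry property and the coisometry property rest on this. -/
lemma cornerProj_sumW_comp_adjoint {a b c : M} (h : a * b = c) :
    cornerProj H a b ∘L R.sumW ∘L R.sumW.adjoint =
      (R.W h ∘L (R.W h).adjoint) ∘L cornerProj H a b := by
  rw [← ContinuousLinearMap.comp_assoc, R.cornerProj_sumW h, ContinuousLinearMap.comp_assoc,
    R.cornerProj_sumW_adjoint h, ContinuousLinearMap.comp_assoc]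

/-! ### The three properties of `W` -/

lemma sumW_ne_zero : R.sumW ≠ 0 := fun h0 => R.W_ne_zero (mul_one (1 : M)) <| by
  -- One nonzero block suffices; the unit provides `W^{(e,e)}`, which acts on the summand `H_e ⊗
  -- H_e`.
  have h1 := R.sumW_corner (mul_one (1 : M))
  rw [h0, ContinuousLinearMap.zero_comp] at h1
  refine ContinuousLinearMap.ext fun z => (corner H (1, 1)).injective ?_
  rw [zero_apply, map_zero]
  exact congr($h1.symm z)

lemma isPartialIsometry_sumW : IsPartialIsometry R.sumW := by
  refine ext_cornerProj fun a b => ?_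
  -- With the bracketing `(W W⋆) W`, the block diagonal form and the relation for `W` leave
  -- `W^{(a,b)} (W^{(a,b)})⋆ W^{(a,b)} P_{ab,b}`.
  rw [← ContinuousLinearMap.comp_assoc R.sumW, ← ContinuousLinearMap.comp_assoc,
    R.cornerProj_sumW_comp_adjoint rfl, ContinuousLinearMap.comp_assoc, R.cornerProj_sumW rfl,
    ← ContinuousLinearMap.comp_assoc, ContinuousLinearMap.comp_assoc (R.W _),
    R.isPartialIsometry]

/-- Moving the projection indexed by `(a, b, c)` to the right changes its index to `(ab, b, c)`,
`(abc, b, c)`, `(abc, bc, c)` on the left-hand side and to `(a, bc, c)`, `(a(bc), bc, c)` on the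
right-hand side. The final indices agree by associativity. -/
lemma pentagon_sumW (hR : R.IsPentagonal) :
    HTensor.leg12 (lp H 2) R.sumW ∘L HTensor.leg13 (lp H 2) R.sumW ∘L
        HTensor.leg23 (lp H 2) R.sumW =
      HTensor.leg23 (lp H 2) R.sumW ∘L HTensor.leg12 (lp H 2) R.sumW := by
  refine ext_map_map_proj fun a b c => ?_
  have h12 := HTensor.map_leg12 (proj (G := H) c) (R.cornerProj_sumW (a := a) (b := b) rfl)
  have h13 := HTensor.map_leg13 (proj (G := H) b) (R.cornerProj_sumW (a := a * b) (b := c) rfl)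
  have h23 := HTensor.map_leg23 (proj (G := H) (a * b * c)) (R.cornerProj_sumW (a := b) (b := c) rfl)
  have h23' := HTensor.map_leg23 (proj (G := H) a) (R.cornerProj_sumW (a := b) (b := c) rfl)
  -- The source is written with `a * b * c` rather than `a * (b * c)`, so that both composites end
  -- at the same space without transport.
  have h12' := HTensor.map_leg12 (proj (G := H) c)
    (R.cornerProj_sumW (a := a) (b := b * c) (mul_assoc a b c).symm)
  have key := hR (a := a) (b := b) (c := c) rfl rfl rfl (mul_assoc a b c).symm
  simp only [cornerProj]
  rw [← ContinuousLinearMap.comp_assoc, h12, ContinuousLinearMap.comp_assoc,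
    ← ContinuousLinearMap.comp_assoc _ _ (HTensor.leg23 _ _), h13, ContinuousLinearMap.comp_assoc,
    h23, ← ContinuousLinearMap.comp_assoc _ (HTensor.leg23 (lp H 2) _), h23',
    ContinuousLinearMap.comp_assoc, h12', ← ContinuousLinearMap.comp_assoc (HTensor.leg23 _ _),
    ← key]
  rfl

/-! ### Covariance and assembly -/

variable [FiniteFactorization M]

lemma isQuasiCovariantRep_sum : IsQuasiCovariantRep S.bialgebra R.sumπ R.sumW where
  ne_zero := R.sumW_ne_zero
  isPartialIsometry := R.isPartialIsometry_sumW
  covariance x := by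
    refine ext_cornerProj fun a b => ?_
    -- `π(x) ⊗ I` is diagonal; it is needed at the index `(ab, b)`, where `P_{a,b}` arrives after
    -- passing `W`.
    have h1 : cornerProj H (a * b) b ∘L HTensor.map (R.sumπ x) (ContinuousLinearMap.id ℂ _) =
        HTensor.map (R.π (a * b) (C0Sum.coord A (a * b) x)) (ContinuousLinearMap.id ℂ _) ∘L
          cornerProj H (a * b) b := by
      rw [cornerProj, HTensor.map_comp, HTensor.map_comp, proj_sumπ, ContinuousLinearMap.comp_id,
        ContinuousLinearMap.id_comp]
    rw [← ContinuousLinearMap.comp_assoc, R.cornerProj_sumW rfl, ContinuousLinearMap.comp_assoc,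
      h1, ← ContinuousLinearMap.comp_assoc, R.covariance, ← ContinuousLinearMap.comp_assoc,
      R.cornerProj_prodRep_sumπ, ContinuousLinearMap.comp_assoc, ContinuousLinearMap.comp_assoc,
      R.cornerProj_sumW rfl]
    -- Both sides are now of the form `(π_a ⊗ π_b)(·) W^{(a,b)} P_{ab,b}`; it remains to identify
    -- the component of `Δ_φ(x)` in `A_a ⊗ A_b`.
    congr 2
    exact (S.map_coord_comul rfl x).symm

lemma isCovariantRep_sum (hR : R.IsCovariant) : IsCovariantRep S.bialgebra R.sumπ R.sumW where
  toIsQuasiCovariantRep := R.isQuasiCovariantRep_sum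
  isometry_adjoint := by
    rw [isometry_adjoint_iff]
    refine ext_cornerProj fun a b => ?_
    rw [R.cornerProj_sumW_comp_adjoint rfl, (isometry_adjoint_iff _).1 (hR rfl),
      ContinuousLinearMap.id_comp, ContinuousLinearMap.comp_id]

lemma isPentagonalRep_sum (hR : R.IsPentagonal) :
    IsPentagonalRep S.bialgebra R.sumπ R.sumW where
  toIsQuasiCovariantRep := R.isQuasiCovariantRep_sum
  pentagon := R.pentagon_sumW hR

end QuasiCovariantRep

end CWCS

end

theorem proposition2p1 {M : Type u} [Monoid M] [IsCancelMul M] [CWCS.FiniteFactorization M]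
    {A : M → Type u} [∀ a, CStarAlgebra (A a)] (S : CWCS.WCS A)
    {H : M → Type u} [∀ a, NormedAddCommGroup (H a)] [∀ a, InnerProductSpace ℂ (H a)]
    [∀ a, CompleteSpace (H a)] (R : CWCS.QuasiCovariantRep S H) :
    CWCS.IsQuasiCovariantRep S.bialgebra R.sumπ R.sumW ∧
    (R.IsCovariant → CWCS.IsCovariantRep S.bialgebra R.sumπ R.sumW) ∧
    (R.IsPentagonal → CWCS.IsPentagonalRep S.bialgebra R.sumπ R.sumW) :=
  ⟨R.isQuasiCovariantRep_sum, R.isCovariantRep_sum, R.isPentagonalRep_sum⟩
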